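/- For $\Omega\subset\mathbb{R}^2_{\ge 0}$ let $X_\Omega=\{(z_1,z_2)\in\mathbb{C}^2 : (\pi|z_1|^2,\pi|z_2|^2)\in\Omega\}$, and for $a,b>0$ let $E(a,b)=\{(z_1,z_2)\in\mathbb{C}^2 : \pi(|z_1|^2/a+|z_2|^2/b)\le 1\}$. Let $\lambda_0=\frac12\sum_{j=1}^2 r_j^2\,d\theta_j=\frac12\sum_{j=1}^2(x_j\,dy_j-y_j\,dx_j)$ be the standard Liouville form on $\mathbb{C}^2$, where $z_j=r_je^{i\theta_j}=x_j+iy_j$. A contact canonical frame for a contact form $\lambda$ on a $3$-manifold $Y$ with Reeb vector field $R$ is a smooth frame $\{R,X_1,X_2\}$ of $TY$ with $X_1,X_2$ sections of $\ker\lambda$, together with smooth functions $I,J,K:Y\to\mathbb{R}$, such that $$[X_2,R]=X_1,\qquad [X_1,X_2]=R+IX_1+JX_2,\qquad [R,X_1]=KX_2 .$$ **Theorem.** Let $\Omega\subset\mathbb{R}^2_{\ge0}$ be nonempty, compact, the closure of an open subset of $\mathbb{R}^2$, and star-shaped with respect to the origin, and suppose that the boundary $\partial X_\Omega$ is smooth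 (i.e. near each of its points $X_\Omega$ is the sublevel set $\{g\le 0\}$ of a smooth function $g$ with $dg\ne0$ at that point). Then $\lambda_0$ restricts to a contact form on $\partial X_\Omega$ admitting a contact canonical frame with $K\equiv1$ if and only if there are $a,b>0$ such that $$X_\Omega=E(a,b)\qquad\text{and}\qquad \pi(a+b)=\frac{ab}{2}.$$ -/

import Mathlib

open scoped ContDiff Topology

noncomputable section

/-- The toric domain `X_Ω ⊆ ℂ²` over a region `Ω` of the plane. -/
def toricDomain (Ω : Set (ℝ × ℝ)) : Set (ℂ × ℂ) :=
  {z | (Real.pi * ‖z.1‖ ^ 2, Real.pi * ‖z.2‖ ^ 2) ∈ Ω}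

/-- The symplectic ellipsoid `E(a, b)` (used for `a, b > 0`). -/
def symplecticEllipsoid (a b : ℝ) : Set (ℂ × ℂ) :=
  {z | Real.pi * (‖z.1‖ ^ 2 / a + ‖z.2‖ ^ 2 / b) ≤ 1}

/-- `g` is a smooth local defining function of `X` at `p`: near `p` the set `X` is `{g ≤ 0}`,
and `dg ≠ 0` at `p`. -/
structure IsLocalDefiningFunction (X : Set (ℂ × ℂ)) (p : ℂ × ℂ) (g : ℂ × ℂ → ℝ) : Prop where
  smooth : ContDiff ℝ ∞ g
  regular : fderiv ℝ g p ≠ 0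
  eventually_mem_iff : ∀ᶠ q in 𝓝 p, q ∈ X ↔ g q ≤ 0

/-- `X` is a domain with smooth boundary: at every boundary point there is a smooth local
defining function. The boundary is then a smooth hypersurface of `ℂ²`. -/
def HasSmoothBoundary (X : Set (ℂ × ℂ)) : Prop :=
  ∀ p ∈ frontier X, ∃ g, IsLocalDefiningFunction X p g

/-- The vector `v` is tangent at `p` to the boundary of `X`: it lies in the kernel of `dg` at `p`
for the local defining functions `g` at `p`. For a domain with smooth boundary there are such
functions, and all of them have the same kernel, the tangent space of the boundary. -/
def IsTangentToBoundary (X : Set (ℂ × ℂ)) (p v : ℂ × ℂ) : Prop :=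
  ∀ g, IsLocalDefiningFunction X p g → fderiv ℝ g p v = 0

/-- `X_Ω` is a (compact) smooth star-shaped toric domain. -/
structure IsSmoothStarShapedToricDomain (Ω : Set (ℝ × ℝ)) : Prop where
  nonneg : ∀ x ∈ Ω, 0 ≤ x.1 ∧ 0 ≤ x.2
  closure_open : ∃ U : Set (ℝ × ℝ), IsOpen U ∧ Ω = closure U
  nonempty : Ω.Nonempty
  compact : IsCompact Ω
  starConvex : StarConvex ℝ 0 Ω
  smooth_boundary : HasSmoothBoundary (toricDomain Ω)

/-- The standard Liouville form `λ₀ = ½ ∑ rⱼ² dθⱼ = ½ ∑ (xⱼ dyⱼ - yⱼ dxⱼ)` on `ℂ²`, that is,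
`λ₀(v) = ½ ∑ Im (conj zⱼ * vⱼ)` at the point `z`. -/
def liouvilleForm (z : ℂ × ℂ) : ℂ × ℂ →L[ℝ] ℝ :=
  (1 / 2 : ℝ) •
    (Complex.imCLM ∘L ContinuousLinearMap.mul ℝ ℂ (starRingEnd ℂ z.1) ∘L
        ContinuousLinearMap.fst ℝ ℂ ℂ
      + Complex.imCLM ∘L ContinuousLinearMap.mul ℝ ℂ (starRingEnd ℂ z.2) ∘L
        ContinuousLinearMap.snd ℝ ℂ ℂ)

/-- The exterior derivative `dα(v, w)` at `p` of a 1-form `α` on `ℂ²`. -/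
def dOneForm (α : ℂ × ℂ → (ℂ × ℂ →L[ℝ] ℝ)) (p v w : ℂ × ℂ) : ℝ :=
  fderiv ℝ α p v w - fderiv ℝ α p w v

/-- The 1-form `α` restricts to a contact form on the boundary of `X`: at each boundary point it
is nonzero on the tangent space, and `dα` is nondegenerate on the contact plane. -/
def IsContactFormOnBoundary (X : Set (ℂ × ℂ)) (α : ℂ × ℂ → (ℂ × ℂ →L[ℝ] ℝ)) : Prop :=
  ∀ p ∈ frontier X,
    (∃ v, IsTangentToBoundary X p v ∧ α p v ≠ 0) ∧
    ∀ v, IsTangentToBoundary X p v → α p v = 0 →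
      (∀ w, IsTangentToBoundary X p w → α p w = 0 → dOneForm α p v w = 0) → v = 0

/-- A smooth vector field on the boundary of `X`, given by an extension to `ℂ²` that is smooth
near the boundary; only its values on the boundary matter. -/
structure IsBoundaryVectorField (X : Set (ℂ × ℂ)) (V : ℂ × ℂ → ℂ × ℂ) : Prop where
  smooth : ∀ p ∈ frontier X, ContDiffAt ℝ ∞ V p
  tangent : ∀ p ∈ frontier X, IsTangentToBoundary X p (V p)

/-- `R` is the Reeb vector field on the boundary of `X` of the contact form induced by `α`. -/
structure IsReebField (X : Set (ℂ × ℂ)) (α : ℂ × ℂ → (ℂ × ℂ →L[ℝ] ℝ))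
    (R : ℂ × ℂ → ℂ × ℂ) : Prop where
  vectorField : IsBoundaryVectorField X R
  normalized : ∀ p ∈ frontier X, α p (R p) = 1
  kernel : ∀ p ∈ frontier X, ∀ v, IsTangentToBoundary X p v → dOneForm α p (R p) v = 0

/-- `{R, X₁, X₂}` is a contact canonical frame for the contact form induced by `α` on the boundary
of `X`, with structure functions `I, J, K`. The Lie bracket at a boundary point of two fields
that are tangent to the boundary does not depend on how they are extended to `ℂ²`. -/
structure IsContactCanonicalFrame (X : Set (ℂ × ℂ)) (α : ℂ × ℂ → (ℂ × ℂ →L[ℝ] ℝ))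
    (R X₁ X₂ : ℂ × ℂ → ℂ × ℂ) (I J K : ℂ × ℂ → ℝ) : Prop where
  contact : IsContactFormOnBoundary X α
  reeb : IsReebField X α R
  vectorField₁ : IsBoundaryVectorField X X₁
  vectorField₂ : IsBoundaryVectorField X X₂
  mem_contact₁ : ∀ p ∈ frontier X, α p (X₁ p) = 0
  mem_contact₂ : ∀ p ∈ frontier X, α p (X₂ p) = 0
  linearIndependent : ∀ p ∈ frontier X, LinearIndependent ℝ ![R p, X₁ p, X₂ p]
  smooth_I : ∀ p ∈ frontier X, ContDiffAt ℝ ∞ I p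
  smooth_J : ∀ p ∈ frontier X, ContDiffAt ℝ ∞ J p
  smooth_K : ∀ p ∈ frontier X, ContDiffAt ℝ ∞ K p
  bracket_X₂_R : ∀ p ∈ frontier X, VectorField.lieBracket ℝ X₂ R p = X₁ p
  bracket_X₁_X₂ : ∀ p ∈ frontier X,
    VectorField.lieBracket ℝ X₁ X₂ p = R p + I p • X₁ p + J p • X₂ p
  bracket_R_X₁ : ∀ p ∈ frontier X, VectorField.lieBracket ℝ R X₁ p = K p • X₂ p

end

/-! Rigidity. Invariance under the torus action makes the orbit directions tangent to the boundary,
and pairing the Reeb field with them under `dλ₀` shows that where both coordinates are nonzero it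
has the form `R = (i ω₁ z₁, i ω₂ z₂)`, with `ω₁ |z₁|² + ω₂ |z₂|² = 2` and `ω₁`, `ω₂` constant on
torus orbits. When `K = 1` the frame satisfies `[R, X₁] = X₂` and `[R, X₂] = -X₁`. Let `sⱼ` be the
component of `Xⱼ` transverse to the tori and `aⱼ` its angular component in `z₁`. Along a Reeb orbit
`(s₁, s₂)` and `(a₁, a₂)` rotate with the same speed, except that the variation of `ω₁` across the
tori, `dω₁ = c s` on the contact plane, adds `c |z₁|² sⱼ` to `aⱼ'`. Hence `s₁² + s₂²` is a positive
constant and `s₁ a₁ + s₂ a₂` has derivative `c |z₁|² (s₁² + s₂²)`. The frame is bounded on the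
compact boundary, so `c = 0` (`IsContactCanonicalFrame.fderiv_angularSpeed_eq_zero`). Both speeds
are then constant along an arc that meets every torus orbit, and the domain is `{a |z₁|² + b |z₂|² ≤
2}` (`IsContactCanonicalFrame.exists_ellipsoid`).

The size. The complex determinant `z₁ v₂ - z₂ v₁` trivializes the contact planes of this ellipsoid.
In it the frame gives a nowhere vanishing function `u = areaForm X₁ + i areaForm X₂` that satisfies
`u' = i (a + b - 1) u` along Reeb orbits. The closed orbit in `z₂ = 0` bounds a disc in the
boundary, so `u` has winding number zero along it, which forces `a + b = 1`
(`IsContactCanonicalFrame.add_eq_one`). For `E(a, b)` the frequencies are `2π/a` and `2π/b`, hence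
the stated equation.

Converse. Let `X_θ` be the contact field whose determinant with `z` is `θ |z|`. If `a + b = 1`, the
Reeb flow turns `θ` with unit speed, so `[R, X_θ] = X_{-iθ}` (`fderiv_contactField_rotationField`),
and `X_1`, `X_{-i}` complete `R` to the required frame. -/

open Complex ComplexConjugate Filter Set

/-! ### The Liouville form and its differential -/

theorem liouvilleForm_apply (z v : ℂ × ℂ) :
    liouvilleForm z v = ((conj z.1 * v.1).im + (conj z.2 * v.2).im) / 2 := by
  simp [liouvilleForm]; ring

/-- The Liouville form as a linear function of the base point. -/
noncomputable def liouvilleCLM : ℂ × ℂ →L[ℝ] ℂ × ℂ →L[ℝ] ℝ :=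
  LinearMap.toContinuousLinearMap
    { toFun := liouvilleForm
      map_add' := fun x y => by
        ext v <;> simp [liouvilleForm_apply] <;> ring
      map_smul' := fun c x => by
        ext v <;> simp [liouvilleForm_apply] <;> ring }

theorem fderiv_liouvilleForm (p : ℂ × ℂ) : fderiv ℝ liouvilleForm p = liouvilleCLM :=
  liouvilleCLM.fderiv

theorem dOneForm_liouvilleForm (p v w : ℂ × ℂ) :
    dOneForm liouvilleForm p v w = (conj v.1 * w.1).im + (conj v.2 * w.2).im := by
  simp only [dOneForm, fderiv_liouvilleForm]
  change liouvilleForm v w - liouvilleForm w v = _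
  simp [liouvilleForm_apply]; ring

/-! ### Defining functions and tangent vectors of the boundary -/

section Boundary

variable {X : Set (ℂ × ℂ)} {p : ℂ × ℂ} {g : ℂ × ℂ → ℝ}

theorem IsLocalDefiningFunction.hasFDerivAt (hg : IsLocalDefiningFunction X p g) (q : ℂ × ℂ) :
    HasFDerivAt g (fderiv ℝ g q) q :=
  (hg.smooth.differentiable (by simp)).differentiableAt.hasFDerivAt

theorem IsLocalDefiningFunction.eventually_regular (hg : IsLocalDefiningFunction X p g) :
    ∀ᶠ q in 𝓝 p, fderiv ℝ g q ≠ 0 :=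
  (hg.smooth.continuous_fderiv (by simp)).continuousAt.eventually_ne hg.regular

theorem exists_pos_of_hasDerivAt {f : ℝ → ℝ} {f' t₀ : ℝ} (hf : HasDerivAt f f' t₀) (hf' : 0 < f')
    (h₀ : f t₀ = 0) : ∀ᶠ t in 𝓝[>] t₀, 0 < f t := by
  have h := (hasDerivAt_iff_tendsto_slope.1 hf).eventually (lt_mem_nhds hf')
  filter_upwards [h.filter_mono (nhdsWithin_mono _ fun x hx => ne_of_gt hx), self_mem_nhdsWithin]
    with t ht ht'
  rw [slope_def_field, h₀, sub_zero] at ht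
  exact (div_pos_iff_of_pos_right (sub_pos.2 ht')).1 ht

theorem hasDerivAt_comp_line {f : ℂ × ℂ → ℝ} {f' : ℂ × ℂ →L[ℝ] ℝ} (hf : HasFDerivAt f f' p)
    (v : ℂ × ℂ) : HasDerivAt (fun t : ℝ => f (p + t • v)) (f' v) 0 := by
  have h : HasDerivAt (fun t : ℝ => p + t • v) v 0 := by
    simpa using ((hasDerivAt_id (0 : ℝ)).smul_const v).const_add p
  exact HasFDerivAt.comp_hasDerivAt (x := (0 : ℝ)) (l := f) (f := fun t : ℝ => p + t • v)
    (by simpa using hf) h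

theorem tendsto_line (p v : ℂ × ℂ) : Tendsto (fun t : ℝ => p + t • v) (𝓝 0) (𝓝 p) := by
  have : Continuous (fun t : ℝ => p + t • v) := by fun_prop
  simpa using this.tendsto 0

/-- Where `g < 0` the set contains a neighbourhood, so such points are interior. -/
theorem IsLocalDefiningFunction.eventually_zero_of_mem (hX : IsClosed X)
    (hg : IsLocalDefiningFunction X p g) : ∀ᶠ q in 𝓝 p, q ∈ frontier X → g q = 0 := by
  filter_upwards [hg.eventually_mem_iff.eventually_nhds] with q hq hqf
  have hmem : q ∈ X := hX.frontier_subset hqf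
  refine le_antisymm ((hq.self_of_nhds).1 hmem) ?_
  by_contra! hlt
  have h1 : ∀ᶠ y in 𝓝 q, g y < 0 := hg.smooth.continuous.continuousAt.eventually_lt_const hlt
  have : q ∈ interior X := by
    rw [mem_interior_iff_mem_nhds]
    filter_upwards [h1, hq] with y h1 h2 using h2.2 h1.le
  exact hqf.2 this

/-- Since `dg ≠ 0` near `p`, moving from a zero of `g` in a direction of increase leaves the set at
once. -/
theorem IsLocalDefiningFunction.eventually_mem_frontier
    (hg : IsLocalDefiningFunction X p g) : ∀ᶠ q in 𝓝 p, g q = 0 → q ∈ frontier X := by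
  filter_upwards [hg.eventually_mem_iff.eventually_nhds, hg.eventually_regular] with q hq hr h0
  have hmem : q ∈ X := hq.self_of_nhds.2 h0.le
  refine ⟨subset_closure hmem, fun hint => ?_⟩
  obtain ⟨v, hv⟩ : ∃ v, 0 < fderiv ℝ g q v := by
    by_contra! hle
    refine hr (ContinuousLinearMap.ext fun v => le_antisymm (hle v) ?_)
    have := hle (-v)
    simpa using this
  have h1 := exists_pos_of_hasDerivAt (hasDerivAt_comp_line (hg.hasFDerivAt q) v) hv (by simpa)
  have h2 : ∀ᶠ t : ℝ in 𝓝[>] 0, q + t • v ∈ interior X :=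
    ((tendsto_line q v).mono_left nhdsWithin_le_nhds).eventually
      (isOpen_interior.mem_nhds hint)
  have h3 : ∀ᶠ t : ℝ in 𝓝[>] 0, q + t • v ∈ X ↔ g (q + t • v) ≤ 0 :=
    ((tendsto_line q v).mono_left nhdsWithin_le_nhds).eventually hq
  obtain ⟨t, ht1, ht2, ht3⟩ := (h1.and (h2.and h3)).exists
  exact absurd (ht3.1 (interior_subset ht2)) (not_le.2 ht1)

theorem IsLocalDefiningFunction.apply_eq_zero (hX : IsClosed X)
    (hg : IsLocalDefiningFunction X p g) (hp : p ∈ frontier X) : g p = 0 :=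
  (hg.eventually_zero_of_mem hX).self_of_nhds hp

/-- This is what makes tangential derivatives depend only on boundary values. It is used for
independence of the defining function and for computing brackets from boundary data. -/
theorem IsLocalDefiningFunction.fderiv_eq_zero_of_vanish (hX : IsClosed X)
    (hg : IsLocalDefiningFunction X p g) (hp : p ∈ frontier X) {f : ℂ × ℂ → ℝ}
    {f' : ℂ × ℂ →L[ℝ] ℝ} (hf : HasStrictFDerivAt f f' p)
    (hf0 : ∀ᶠ q in 𝓝 p, q ∈ frontier X → f q = 0) {v : ℂ × ℂ} (hv : fderiv ℝ g p v = 0) :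
    f' v = 0 := by
  -- As `f` is constant on the level set of `g`, the point is trivially a constrained extremum;
  -- Lagrange multipliers then make `df` proportional to `dg`.
  have hext : IsLocalExtrOn f {q | g q = g p} p := by
    refine Or.inl ?_
    have h := hg.eventually_mem_frontier.and hf0
    refine eventually_nhdsWithin_iff.2 ?_
    filter_upwards [h] with q hq hgq
    rw [hf0.self_of_nhds hp, hq.2 (hq.1 (by rw [hgq, hg.apply_eq_zero hX hp]))]
  obtain ⟨a, b, hab, h⟩ := hext.exists_multipliers_of_hasStrictFDerivAt_1d
    (hg.smooth.contDiffAt.hasStrictFDerivAt (by simp)) hf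
  have hb : b ≠ 0 := by
    rintro rfl
    simp only [zero_smul, add_zero] at h
    rcases smul_eq_zero.1 h with rfl | h
    · exact hab rfl
    · exact hg.regular h
  have := congrArg (fun L : ℂ × ℂ →L[ℝ] ℝ => L v) h
  simpa [hv, hb] using this

theorem IsLocalDefiningFunction.isTangent_iff (hX : IsClosed X)
    (hg : IsLocalDefiningFunction X p g) (hp : p ∈ frontier X) {v : ℂ × ℂ} :
    IsTangentToBoundary X p v ↔ fderiv ℝ g p v = 0 :=
  ⟨fun h => h g hg, fun h _ hk => hg.fderiv_eq_zero_of_vanish hX hp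
    (hk.smooth.contDiffAt.hasStrictFDerivAt (by simp)) (hk.eventually_zero_of_mem hX) h⟩

theorem IsTangentToBoundary.fderiv_eq_zero (hX : IsClosed X) (hs : HasSmoothBoundary X)
    (hp : p ∈ frontier X) {v : ℂ × ℂ} (hv : IsTangentToBoundary X p v)
    {F : Type*} [NormedAddCommGroup F] [NormedSpace ℝ F] {f : ℂ × ℂ → F}
    (hf : ContDiffAt ℝ ∞ f p) (hf0 : ∀ᶠ q in 𝓝 p, q ∈ frontier X → f q = 0) :
    fderiv ℝ f p v = 0 := by
  obtain ⟨g, hg⟩ := hs p hp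
  refine SeparatingDual.eq_zero_of_forall_dual_eq_zero (R := ℝ) fun φ => ?_
  have h := (φ.hasStrictFDerivAt (x := f p)).comp p (hf.hasStrictFDerivAt (by simp))
  exact hg.fderiv_eq_zero_of_vanish hX hp h
    (by filter_upwards [hf0] with q hq hqf; simp [hq hqf]) (hv g hg)

theorem IsTangentToBoundary.fderiv_eq (hX : IsClosed X) (hs : HasSmoothBoundary X)
    (hp : p ∈ frontier X) {v : ℂ × ℂ} (hv : IsTangentToBoundary X p v)
    {F : Type*} [NormedAddCommGroup F] [NormedSpace ℝ F] {f k : ℂ × ℂ → F}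
    (hf : ContDiffAt ℝ ∞ f p) (hk : ContDiffAt ℝ ∞ k p)
    (hfk : ∀ᶠ q in 𝓝 p, q ∈ frontier X → f q = k q) :
    fderiv ℝ f p v = fderiv ℝ k p v := by
  have h := hv.fderiv_eq_zero hX hs hp (hf.sub hk)
    (by filter_upwards [hfk] with q hq hqf; simp [hq hqf])
  have h2 : fderiv ℝ (f - k) p = fderiv ℝ f p - fderiv ℝ k p :=
    fderiv_sub (hf.differentiableAt (by simp)) (hk.differentiableAt (by simp))
  rw [show (fun x => f x - k x) = f - k from rfl, h2] at h
  simpa [sub_eq_zero] using h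

theorem IsTangentToBoundary.add {v w : ℂ × ℂ} (hv : IsTangentToBoundary X p v)
    (hw : IsTangentToBoundary X p w) : IsTangentToBoundary X p (v + w) :=
  fun g hg => by rw [map_add, hv g hg, hw g hg, add_zero]

theorem IsTangentToBoundary.smul {v : ℂ × ℂ} (hv : IsTangentToBoundary X p v) (c : ℝ) :
    IsTangentToBoundary X p (c • v) :=
  fun g hg => by rw [map_smul, hv g hg, smul_zero]

theorem IsTangentToBoundary.sub {v w : ℂ × ℂ} (hv : IsTangentToBoundary X p v)
    (hw : IsTangentToBoundary X p w) : IsTangentToBoundary X p (v - w) :=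
  fun g hg => by rw [map_sub, hv g hg, hw g hg, sub_zero]

theorem isTangentToBoundary_of_hasDerivAt (hX : IsClosed X) {γ : ℝ → ℂ × ℂ} {v : ℂ × ℂ} {t : ℝ}
    (hγ : HasDerivAt γ v t) (hmem : ∀ᶠ s in 𝓝 t, γ s ∈ frontier X) :
    IsTangentToBoundary X (γ t) v := by
  intro g hg
  have h1 : HasDerivAt (g ∘ γ) (fderiv ℝ g (γ t) v) t :=
    (hg.hasFDerivAt (γ t)).comp_hasDerivAt t hγ
  have h2 : g ∘ γ =ᶠ[𝓝 t] fun _ => 0 := by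
    filter_upwards [hmem, hγ.continuousAt.eventually (hg.eventually_zero_of_mem hX)]
      with s h1 h2 using h2 h1
  exact (h1.congr_of_eventuallyEq h2.symm).unique (hasDerivAt_const t 0)

end Boundary

/-! ### The torus action -/

/-- The rotation `(z₁, z₂) ↦ (c z₁, d z₂)` of `ℂ²`. -/
noncomputable def torusRotation (c d : Circle) : (ℂ × ℂ) ≃L[ℝ] (ℂ × ℂ) :=
  (rotation c).toContinuousLinearEquiv.prodCongr (rotation d).toContinuousLinearEquiv

@[simp]
theorem torusRotation_apply (c d : Circle) (z : ℂ × ℂ) :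
    torusRotation c d z = (c * z.1, d * z.2) := rfl

theorem conj_mul_self_circle (c : Circle) : conj (c : ℂ) * c = 1 := by
  rw [← Circle.coe_inv_eq_conj, ← Circle.coe_mul, inv_mul_cancel, Circle.coe_one]

theorem conj_mul_circle_mul (c : Circle) (z w : ℂ) :
    conj ((c : ℂ) * z) * (c * w) = conj z * w := by
  rw [map_mul]
  linear_combination (conj z * w) * conj_mul_self_circle c

@[simp]
theorem torusRotation_inv_apply (c d : Circle) (z : ℂ × ℂ) :
    torusRotation c⁻¹ d⁻¹ (torusRotation c d z) = z := by
  ext <;> simp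

@[simp]
theorem torusRotation_apply_inv (c d : Circle) (z : ℂ × ℂ) :
    torusRotation c d (torusRotation c⁻¹ d⁻¹ z) = z := by
  ext <;> simp

/-- Invariance under the standard torus action on `ℂ²`. -/
def IsTorusInvariant (X : Set (ℂ × ℂ)) : Prop :=
  ∀ (c d : Circle) (z : ℂ × ℂ), torusRotation c d z ∈ X ↔ z ∈ X

theorem isTorusInvariant_toricDomain (Ω : Set (ℝ × ℝ)) : IsTorusInvariant (toricDomain Ω) := by
  intro c d z
  simp [toricDomain, Circle.norm_coe]


theorem IsTorusInvariant.mem_frontier_iff {X : Set (ℂ × ℂ)} (hT : IsTorusInvariant X)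
    (c d : Circle) (z : ℂ × ℂ) :
    torusRotation c d z ∈ frontier X ↔ z ∈ frontier X := by
  have h := (torusRotation c d).toHomeomorph.preimage_frontier X
  have h2 : (torusRotation c d).toHomeomorph ⁻¹' X = X := Set.ext fun z => hT c d z
  rw [h2] at h
  exact Set.ext_iff.1 h z

theorem IsTorusInvariant.isLocalDefiningFunction_comp {X : Set (ℂ × ℂ)} (hT : IsTorusInvariant X)
    {c d : Circle} {p : ℂ × ℂ} {g : ℂ × ℂ → ℝ}
    (hg : IsLocalDefiningFunction X (torusRotation c d p) g) :
    IsLocalDefiningFunction X p (g ∘ torusRotation c d) where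
  smooth := hg.smooth.comp (torusRotation c d).contDiff
  regular := by
    rw [(torusRotation c d).comp_right_fderiv]
    intro h
    refine hg.regular (ContinuousLinearMap.ext fun v => ?_)
    have := congrArg (fun L : ℂ × ℂ →L[ℝ] ℝ => L (torusRotation c⁻¹ d⁻¹ v)) h
    simpa using this
  eventually_mem_iff := by
    have := ((torusRotation c d).continuous.tendsto p).eventually hg.eventually_mem_iff
    filter_upwards [this] with q hq
    rw [← hT c d q, hq, Function.comp]

theorem IsTorusInvariant.isTangent {X : Set (ℂ × ℂ)} (hT : IsTorusInvariant X)
    {c d : Circle} {p v : ℂ × ℂ}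
    (hv : IsTangentToBoundary X p v) :
    IsTangentToBoundary X (torusRotation c d p) (torusRotation c d v) := by
  intro g hg
  have h := hv _ (hT.isLocalDefiningFunction_comp hg)
  rwa [(torusRotation c d).comp_right_fderiv] at h

theorem IsTorusInvariant.isTangent_symm {X : Set (ℂ × ℂ)} (hT : IsTorusInvariant X)
    {c d : Circle} {p v : ℂ × ℂ}
    (hv : IsTangentToBoundary X (torusRotation c d p) v) :
    IsTangentToBoundary X p (torusRotation c⁻¹ d⁻¹ v) := by
  simpa only [torusRotation_inv_apply] using hT.isTangent (c := c⁻¹) (d := d⁻¹) hv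

theorem hasDerivAt_circle_exp (a t : ℝ) :
    HasDerivAt (fun t : ℝ => (Circle.exp (a * t) : ℂ)) (I * a * Circle.exp (a * t)) t := by
  have h : HasDerivAt (fun t : ℝ => ((a * t : ℝ) : ℂ) * I) (a * I) t := by
    have := (((hasDerivAt_id t).const_mul a).ofReal_comp).mul_const I
    simpa using this
  have := h.cexp
  simp only [Circle.coe_exp]
  convert this using 1; ring

/-- The orbit of `p` under the linear flow of rotations with frequencies `a` and `b`. -/
noncomputable def torusOrbit (a b : ℝ) (p : ℂ × ℂ) (t : ℝ) : ℂ × ℂ :=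
  torusRotation (Circle.exp (a * t)) (Circle.exp (b * t)) p

theorem hasDerivAt_torusOrbit (a b : ℝ) (p : ℂ × ℂ) (t : ℝ) :
    HasDerivAt (torusOrbit a b p)
      (I * a * (torusOrbit a b p t).1, I * b * (torusOrbit a b p t).2) t := by
  have h1 := (hasDerivAt_circle_exp a t).mul_const p.1
  have h2 := (hasDerivAt_circle_exp b t).mul_const p.2
  unfold torusOrbit
  simp only [torusRotation_apply, ← mul_assoc]
  exact h1.prodMk h2

@[simp]
theorem torusOrbit_zero (a b : ℝ) (p : ℂ × ℂ) : torusOrbit a b p 0 = p := by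
  simp [torusOrbit]


theorem IsTorusInvariant.torusOrbit_mem {X : Set (ℂ × ℂ)} (hT : IsTorusInvariant X)
    {p : ℂ × ℂ} (hp : p ∈ frontier X) (a b t : ℝ) :
    torusOrbit a b p t ∈ frontier X :=
  (hT.mem_frontier_iff _ _ _).2 hp

theorem IsTorusInvariant.isTangent_rotation {X : Set (ℂ × ℂ)} (hT : IsTorusInvariant X)
    {p : ℂ × ℂ} (hX : IsClosed X) (hp : p ∈ frontier X) (a b : ℝ) :
    IsTangentToBoundary X p (I * a * p.1, I * b * p.2) := by
  have := isTangentToBoundary_of_hasDerivAt hX (hasDerivAt_torusOrbit a b p 0)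
    (Eventually.of_forall fun t => hT.torusOrbit_mem hp a b t)
  simpa using this

/-- The difference lies in the contact plane and in the kernel of `dλ₀` there. -/
theorem reeb_unique {X : Set (ℂ × ℂ)} (hc : IsContactFormOnBoundary X liouvilleForm)
    {p v w : ℂ × ℂ} (hp : p ∈ frontier X)
    (hv : IsTangentToBoundary X p v) (hw : IsTangentToBoundary X p w)
    (hv1 : liouvilleForm p v = 1) (hw1 : liouvilleForm p w = 1)
    (hv0 : ∀ u, IsTangentToBoundary X p u → dOneForm liouvilleForm p v u = 0)
    (hw0 : ∀ u, IsTangentToBoundary X p u → dOneForm liouvilleForm p w u = 0) : v = w := by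
  refine sub_eq_zero.1 ((hc p hp).2 _ (hv.sub hw) (by rw [map_sub, hv1, hw1, sub_self]) ?_)
  intro u hu _
  have h1 := hv0 u hu
  have h2 := hw0 u hu
  simp only [dOneForm, fderiv_liouvilleForm, map_sub, sub_apply] at *
  linarith

/-! ### Topology of toric domains -/

theorem isClosed_toricDomain {Ω : Set (ℝ × ℝ)} (hΩ : IsClosed Ω) : IsClosed (toricDomain Ω) :=
  hΩ.preimage (f := fun z : ℂ × ℂ => (Real.pi * ‖z.1‖ ^ 2, Real.pi * ‖z.2‖ ^ 2)) (by fun_prop)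

theorem isCompact_toricDomain {Ω : Set (ℝ × ℝ)} (hΩ : IsCompact Ω) :
    IsCompact (toricDomain Ω) := by
  refine Metric.isCompact_of_isClosed_isBounded (isClosed_toricDomain hΩ.isClosed) ?_
  obtain ⟨C, hC⟩ := hΩ.isBounded.exists_norm_le
  refine isBounded_iff_forall_norm_le.2 ⟨max 1 C, fun z hz => ?_⟩
  have key : ∀ r : ℝ, 0 ≤ r → Real.pi * r ^ 2 ≤ C → r ≤ max 1 C := by
    intro r hr h
    rcases le_total r 1 with h1 | h1
    · exact h1.trans (le_max_left _ _)
    · refine le_trans ?_ (le_max_right _ _)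
      have := Real.pi_gt_three
      nlinarith
  have h := hC _ hz
  rw [Prod.norm_def, max_le_iff] at h
  rw [Prod.norm_def, max_le_iff]
  exact ⟨key _ (norm_nonneg _) ((le_abs_self _).trans h.1),
    key _ (norm_nonneg _) ((le_abs_self _).trans h.2)⟩

theorem starConvex_toricDomain {Ω : Set (ℝ × ℝ)} (hΩ : StarConvex ℝ 0 Ω) {z : ℂ × ℂ}
    (hz : z ∈ toricDomain Ω) {t : ℝ} (h0 : 0 ≤ t) (h1 : t ≤ 1) : t • z ∈ toricDomain Ω := by
  have h := hΩ hz (sub_nonneg.2 (pow_le_one₀ h0 h1 : t ^ 2 ≤ 1)) (sq_nonneg t) (by ring)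
  simp only [smul_zero, zero_add, Prod.smul_mk, smul_eq_mul] at h
  simp only [toricDomain, mem_ofPred_eq, Prod.smul_fst, Prod.smul_snd, norm_smul,
    Real.norm_eq_abs, mul_pow, sq_abs]
  convert h using 2 <;> ring

/-! ### Transversality of the radial direction -/

section Radial

variable {X : Set (ℂ × ℂ)} {p z : ℂ × ℂ} {t : ℝ}

/-- A smooth boundary through `0` would separate `t v` from `-t v` for small `t > 0` and a suitable
`v`, while the set is symmetric under `z ↦ -z`. -/
theorem zero_mem_interior (hT : IsTorusInvariant X) (hs : HasSmoothBoundary X)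
    (h0 : (0 : ℂ × ℂ) ∈ X) : (0 : ℂ × ℂ) ∈ interior X := by
  by_contra hint
  obtain ⟨g, hg⟩ := hs 0 ⟨subset_closure h0, hint⟩
  have hneg : ∀ z, -z ∈ X ↔ z ∈ X := fun z => by
    have h := hT (Circle.exp Real.pi) (Circle.exp Real.pi) z
    rwa [show torusRotation (Circle.exp Real.pi) (Circle.exp Real.pi) z = -z by
      ext <;> simp] at h
  have hg0 : g 0 ≤ 0 := (hg.eventually_mem_iff.self_of_nhds).1 h0
  obtain ⟨v, hv⟩ : ∃ v, 0 < fderiv ℝ g 0 v := by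
    by_contra! hle
    refine hg.regular (ContinuousLinearMap.ext fun v => le_antisymm (hle v) ?_)
    have := hle (-v)
    simpa using this
  have hlim : ∀ w : ℂ × ℂ, Tendsto (fun t : ℝ => 0 + t • w) (𝓝[>] 0) (𝓝 0) := fun w =>
    (tendsto_line 0 w).mono_left nhdsWithin_le_nhds
  have h1 := exists_pos_of_hasDerivAt ((hasDerivAt_comp_line (hg.hasFDerivAt 0) v).sub_const (g 0))
    hv (by simp)
  have h2 := exists_pos_of_hasDerivAt
    ((hasDerivAt_comp_line (hg.hasFDerivAt 0) (-v)).const_sub (g 0)) (by simpa using hv) (by simp)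
  have h3 := (hlim v).eventually hg.eventually_mem_iff
  have h4 := (hlim (-v)).eventually hg.eventually_mem_iff
  have hg0' : g 0 = 0 := by
    refine le_antisymm hg0 ?_
    by_contra! hlt
    refine hint (mem_interior_iff_mem_nhds.2 ?_)
    filter_upwards [hg.eventually_mem_iff,
      hg.smooth.continuous.continuousAt.eventually_lt_const hlt] with q hq hq'
    exact hq.2 hq'.le
  obtain ⟨t, h1, h2, h3, h4⟩ := (h1.and (h2.and (h3.and h4))).exists
  rw [hg0', sub_zero] at h1
  rw [hg0', zero_sub] at h2
  refine absurd (h3.1 ?_) (not_le.2 h1)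
  rw [← hneg]
  have : 0 + t • -v ∈ X := h4.2 (by linarith)
  simpa using this

theorem ne_zero_of_mem_frontier (h0 : (0 : ℂ × ℂ) ∈ interior X) (hp : p ∈ frontier X) : p ≠ 0 := by
  rintro rfl
  exact hp.2 h0

/-- At `p` one has `λ₀(p) = 0` and `dλ₀(p, ·) = 2 λ₀`, so a tangent radial vector would be a
degenerate direction of `dλ₀` on the contact plane. -/
theorem not_isTangent_radial (hc : IsContactFormOnBoundary X liouvilleForm)
    (h0 : (0 : ℂ × ℂ) ∈ interior X) (hp : p ∈ frontier X) : ¬ IsTangentToBoundary X p p := by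
  intro h
  refine ne_zero_of_mem_frontier h0 hp ((hc p hp).2 p h ?_ ?_)
  · simp [liouvilleForm_apply, mul_comm, Complex.mul_conj]
  · intro w _ hw
    rw [liouvilleForm_apply] at hw
    rw [dOneForm_liouvilleForm]
    linarith

theorem IsLocalDefiningFunction.radial_pos (hX : IsClosed X)
    (hc : IsContactFormOnBoundary X liouvilleForm) (h0 : (0 : ℂ × ℂ) ∈ interior X)
    (hstar : ∀ z ∈ X, ∀ t : ℝ, 0 ≤ t → t ≤ 1 → t • z ∈ X) (hp : p ∈ frontier X)
    {g : ℂ × ℂ → ℝ} (hg : IsLocalDefiningFunction X p g) : 0 < fderiv ℝ g p p := by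
  refine lt_of_le_of_ne ?_ fun h =>
    not_isTangent_radial hc h0 hp ((hg.isTangent_iff hX hp).2 h.symm)
  by_contra! hlt
  have h1 := exists_pos_of_hasDerivAt (hasDerivAt_comp_line (hg.hasFDerivAt p) (-p))
    (by simpa using hlt) (by simpa using hg.apply_eq_zero hX hp)
  have h2 := ((tendsto_line p (-p)).mono_left nhdsWithin_le_nhds).eventually
    hg.eventually_mem_iff (f := fun t : ℝ => p + t • -p) (l₁ := 𝓝[>] 0)
  have h3 : ∀ᶠ t : ℝ in 𝓝[>] 0, t ≤ 1 :=
    nhdsWithin_le_nhds (ge_mem_nhds one_pos)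
  obtain ⟨t, h1, h2, h3, h4⟩ := (h1.and (h2.and (h3.and self_mem_nhdsWithin))).exists
  refine absurd (h2.1 ?_) (not_le.2 h1)
  rw [show p + t • -p = (1 - t) • p by module]
  exact hstar p (hX.frontier_subset hp) _ (by linarith) (by linarith [show (0 : ℝ) < t from h4])

/-- The defining function increases strictly along the ray at `p`, so points just beyond `p` lie
outside; star-shapedness then excludes all farther ones. -/
theorem smul_notMem (hX : IsClosed X) (hs : HasSmoothBoundary X)
    (hc : IsContactFormOnBoundary X liouvilleForm) (h0 : (0 : ℂ × ℂ) ∈ interior X)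
    (hstar : ∀ z ∈ X, ∀ t : ℝ, 0 ≤ t → t ≤ 1 → t • z ∈ X) (hp : p ∈ frontier X) (ht : 1 < t) :
    t • p ∉ X := by
  intro hmem
  obtain ⟨g, hg⟩ := hs p hp
  have h1 := exists_pos_of_hasDerivAt (hasDerivAt_comp_line (hg.hasFDerivAt p) p)
    (hg.radial_pos hX hc h0 hstar hp) (by simpa using hg.apply_eq_zero hX hp)
  have h2 : ∀ᶠ s : ℝ in 𝓝[>] 0, p + s • p ∈ X ↔ g (p + s • p) ≤ 0 :=
    ((tendsto_line p p).mono_left nhdsWithin_le_nhds).eventually hg.eventually_mem_iff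
  have h3 : ∀ᶠ s : ℝ in 𝓝[>] 0, s ≤ t - 1 :=
    nhdsWithin_le_nhds (ge_mem_nhds (sub_pos.2 ht))
  obtain ⟨s, h1, h2, h3, h4⟩ := (h1.and (h2.and (h3.and self_mem_nhdsWithin))).exists
  have h4 : 0 < s := h4
  refine absurd (h2.1 ?_) (not_le.2 h1)
  have ht0 : t ≠ 0 := by linarith
  rw [show p + s • p = ((1 + s) / t) • (t • p) by
    rw [smul_smul, div_mul_cancel₀ _ ht0, add_smul, one_smul]]
  refine hstar _ hmem _ (by positivity) ((div_le_one (by linarith)).2 (by linarith))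

theorem eq_one_of_smul_mem_frontier (hX : IsClosed X) (hs : HasSmoothBoundary X)
    (hc : IsContactFormOnBoundary X liouvilleForm) (h0 : (0 : ℂ × ℂ) ∈ interior X)
    (hstar : ∀ z ∈ X, ∀ t : ℝ, 0 ≤ t → t ≤ 1 → t • z ∈ X) (hp : p ∈ frontier X)
    (hp' : t • p ∈ frontier X) (ht : 0 < t) : t = 1 := by
  rcases lt_trichotomy t 1 with h | h | h
  · refine absurd (hX.frontier_subset hp) ?_
    have := smul_notMem hX hs hc h0 hstar hp' ((one_lt_inv₀ ht).2 h)
    rwa [smul_smul, inv_mul_cancel₀ ht.ne', one_smul] at this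
  · exact h
  · exact absurd (hX.frontier_subset hp') (smul_notMem hX hs hc h0 hstar hp h)

theorem exists_smul_mem_frontier (hX : IsCompact X) (hT : IsTorusInvariant X)
    (h0 : (0 : ℂ × ℂ) ∈ interior X) (hz : z ≠ 0) : ∃ t : ℝ, 0 < t ∧ t • z ∈ frontier X := by
  have hcont : Continuous fun t : ℝ => t • z := by fun_prop
  obtain ⟨C, hC⟩ := hX.isBounded.exists_norm_le
  have hne : ((fun t : ℝ => t • z) ⁻¹' X) ≠ univ := by
    intro h
    have : (|C| + 1) / ‖z‖ ∈ (fun t : ℝ => t • z) ⁻¹' X := h ▸ mem_univ _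
    have := hC _ this
    rw [norm_smul, norm_div, norm_norm, div_mul_cancel₀ _ (norm_ne_zero_iff.2 hz),
      Real.norm_of_nonneg (by positivity)] at this
    linarith [le_abs_self C]
  obtain ⟨t, ht⟩ := nonempty_frontier_iff.2
    ⟨⟨0, by simpa using interior_subset h0⟩, hne⟩
  have ht : t • z ∈ frontier X := hcont.frontier_preimage_subset X ht
  -- The boundary parameter found on the line may be negative; the rotation by `-1` in both
  -- coordinates flips its sign.
  rcases lt_trichotomy t 0 with h | h | h
  · refine ⟨-t, neg_pos.2 h, ?_⟩
    have := (hT.mem_frontier_iff (Circle.exp Real.pi) (Circle.exp Real.pi) _).2 ht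
    rwa [show torusRotation (Circle.exp Real.pi) (Circle.exp Real.pi) (t • z) = (-t) • z by
      ext <;> simp] at this
  · subst h
    rw [zero_smul] at ht
    exact absurd h0 ht.2
  · exact ⟨t, h, ht⟩

end Radial

/-! ### Torus-invariant functions on the boundary -/

section Invariant

variable {X : Set (ℂ × ℂ)} {p v : ℂ × ℂ} {f : ℂ × ℂ → ℝ}

theorem fderiv_rotation_of_invariant (hX : IsClosed X) (hs : HasSmoothBoundary X)
    (hp : p ∈ frontier X)
    (hf : ∀ (c d : Circle), ∀ q ∈ frontier X, f (torusRotation c d q) = f q) (c d : Circle)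
    (hfp : ContDiffAt ℝ ∞ f p) (hfq : ContDiffAt ℝ ∞ f (torusRotation c d p))
    (hv : IsTangentToBoundary X p v) :
    fderiv ℝ f (torusRotation c d p) (torusRotation c d v) = fderiv ℝ f p v := by
  have h := hv.fderiv_eq hX hs hp (f := f ∘ torusRotation c d) (k := f)
    (hfq.comp p (torusRotation c d).contDiff.contDiffAt) hfp
    (Eventually.of_forall fun q hq => hf c d q hq)
  rwa [(torusRotation c d).comp_right_fderiv] at h

theorem fderiv_orbit_of_invariant (hp : p ∈ frontier X)
    (hf : ∀ (c d : Circle), ∀ q ∈ frontier X, f (torusRotation c d q) = f q)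
    (hfp : ContDiffAt ℝ ∞ f p) (a b : ℝ) : fderiv ℝ f p (I * a * p.1, I * b * p.2) = 0 := by
  have h := hasDerivAt_torusOrbit a b p 0
  have h2 : HasFDerivAt f (fderiv ℝ f (torusOrbit a b p 0)) (torusOrbit a b p 0) := by
    rw [torusOrbit_zero]
    exact (hfp.differentiableAt (by simp)).hasFDerivAt
  have h3 := h2.comp_hasDerivAt 0 h
  have h4 : f ∘ torusOrbit a b p = fun _ => f p := funext fun t => hf _ _ p hp
  rw [h4] at h3
  have := h3.unique (hasDerivAt_const _ _)
  simpa using this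

end Invariant

/-! ### Angular speeds and derivatives along rotating orbits -/

/-- The angular speed of the vector field `R` around the origin in the complex coordinate `π`. -/
noncomputable def angularSpeed (π : ℂ × ℂ →L[ℝ] ℂ) (R : ℂ × ℂ → ℂ × ℂ) (z : ℂ × ℂ) : ℝ :=
  (conj (π z) * π (R z)).im / normSq (π z)

theorem contDiffAt_angularSpeed (π : ℂ × ℂ →L[ℝ] ℂ) {R : ℂ × ℂ → ℂ × ℂ} {p : ℂ × ℂ}
    (hR : ContDiffAt ℝ ∞ R p) (hp : π p ≠ 0) : ContDiffAt ℝ ∞ (angularSpeed π R) p := by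
  have h1 : ContDiffAt ℝ ∞ (fun z => π z) p := π.contDiff.contDiffAt
  have h2 : ContDiffAt ℝ ∞ (fun z => π (R z)) p := π.contDiff.contDiffAt.comp p hR
  have h3 : ContDiffAt ℝ ∞ (fun z => conj (π z)) p := conjCLE.contDiff.contDiffAt.comp p h1
  have hre : ∀ {u : ℂ × ℂ → ℂ}, ContDiffAt ℝ ∞ u p → ContDiffAt ℝ ∞ (fun z => (u z).re) p :=
    fun hu => reCLM.contDiff.contDiffAt.comp p hu
  have him : ∀ {u : ℂ × ℂ → ℂ}, ContDiffAt ℝ ∞ u p → ContDiffAt ℝ ∞ (fun z => (u z).im) p :=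
    fun hu => imCLM.contDiff.contDiffAt.comp p hu
  unfold angularSpeed
  simp only [normSq_apply]
  refine (him (h3.mul h2)).div (((hre h1).mul (hre h1)).add ((him h1).mul (him h1))) ?_
  rw [← normSq_apply]
  exact (normSq_pos.2 hp).ne'

theorem eq_rotation_of_conj_mul_re {z v : ℂ} (hz : z ≠ 0) (h : (conj z * v).re = 0) :
    v = I * ((conj z * v).im / normSq z : ℝ) * z := by
  have h0 : (normSq z : ℂ) ≠ 0 := by exact_mod_cast (normSq_pos.2 hz).ne'
  have h1 : conj z * v = I * ((conj z * v).im : ℝ) := by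
    generalize conj z * v = w at *
    apply Complex.ext <;> simp [h]
  have h2 : conj z ≠ 0 := by simpa using hz
  refine mul_left_cancel₀ h2 ?_
  have h3 : conj z * (I * ((conj z * v).im / normSq z : ℝ) * z) =
    I * ((conj z * v).im / normSq z : ℝ) * normSq z := by
    rw [normSq_eq_conj_mul_self]; ring
  rw [h3, h1]
  generalize (conj z * v).im = w
  simp
  field_simp

theorem eq_angularSpeed_mul {π : ℂ × ℂ →L[ℝ] ℂ} {R : ℂ × ℂ → ℂ × ℂ} {p : ℂ × ℂ}
    (hre : (conj (π p) * π (R p)).re = 0) (hp : π p ≠ 0) :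
    π (R p) = I * angularSpeed π R p * π p :=
  eq_rotation_of_conj_mul_re hp hre

theorem IsTangentToBoundary.fderiv_rotating {X : Set (ℂ × ℂ)} (hX : IsClosed X)
    (hs : HasSmoothBoundary X) {p v : ℂ × ℂ} (hp : p ∈ frontier X)
    (hv : IsTangentToBoundary X p v) {R : ℂ × ℂ → ℂ × ℂ} (hR : ContDiffAt ℝ ∞ R p)
    (π : ℂ × ℂ →L[ℝ] ℂ) {f : ℂ × ℂ → ℝ} (hf : ContDiffAt ℝ ∞ f p)
    (h : ∀ᶠ q in 𝓝 p, q ∈ frontier X → π (R q) = I * f q * π q) :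
    π (fderiv ℝ R p v) = I * (f p * π v + fderiv ℝ f p v * π p) := by
  have h1 := hv.fderiv_eq hX hs hp (f := π ∘ R) (k := fun q => I * f q * π q)
    (π.contDiff.contDiffAt.comp p hR)
    ((contDiffAt_const.mul (ofRealCLM.contDiff.contDiffAt.comp p hf)).mul π.contDiff.contDiffAt) h
  have h2 : HasFDerivAt (π ∘ R) (π ∘L fderiv ℝ R p) p :=
    π.hasFDerivAt.comp p (hR.differentiableAt (by simp)).hasFDerivAt
  have h3 : HasFDerivAt (fun q => ((f q : ℝ) : ℂ)) (ofRealCLM ∘L fderiv ℝ f p) p :=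
    ofRealCLM.hasFDerivAt.comp p (hf.differentiableAt (by simp)).hasFDerivAt
  have h4 : HasFDerivAt (fun q => I * f q * π q) _ p :=
    (h3.const_mul I).mul (π.hasFDerivAt (x := p))
  rw [h2.fderiv, h4.fderiv] at h1
  simp at h1
  rw [h1]
  ring

/-- The factor `conj (π γ)` cancels the rotation of `π (Y γ)`. What survives is the bracket `W` and
a purely imaginary shear term, with `k` the derivative of the angular speed in the direction `Y`. -/
theorem hasDerivAt_conj_mul_comp (π : ℂ × ℂ →L[ℝ] ℂ) {R Y : ℂ × ℂ → ℂ × ℂ} {γ : ℝ → ℂ × ℂ}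
    {t a k : ℝ} {W : ℂ × ℂ} (hγ : HasDerivAt γ (R (γ t)) t) (hR : π (R (γ t)) = I * a * π (γ t))
    (hDR : π (fderiv ℝ R (γ t) (Y (γ t))) = I * (a * π (Y (γ t)) + k * π (γ t)))
    (hY : DifferentiableAt ℝ Y (γ t))
    (hbr : fderiv ℝ Y (γ t) (R (γ t)) = fderiv ℝ R (γ t) (Y (γ t)) + W) :
    HasDerivAt (fun t => conj (π (γ t)) * π (Y (γ t)))
      (conj (π (γ t)) * π W + I * k * normSq (π (γ t))) t := by
  have h1 : HasDerivAt (fun t => π (γ t)) (π (R (γ t))) t := π.hasFDerivAt.comp_hasDerivAt t hγ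
  have h2 : HasDerivAt (fun t => conj (π (γ t))) (conj (π (R (γ t)))) t :=
    conjCLE.toContinuousLinearMap.hasFDerivAt.comp_hasDerivAt t h1
  have h3 : HasDerivAt (fun t => π (Y (γ t))) (π (fderiv ℝ Y (γ t) (R (γ t)))) t :=
    π.hasFDerivAt.comp_hasDerivAt t (hY.hasFDerivAt.comp_hasDerivAt t hγ)
  have h4 := h2.mul h3
  refine HasDerivAt.congr_deriv h4 ?_
  rw [hbr, map_add, hDR, hR, normSq_eq_conj_mul_self]
  simp only [map_mul, conj_I, conj_ofReal]
  ring

theorem HasDerivAt.complex_re {f : ℝ → ℂ} {f' : ℂ} {t : ℝ} (h : HasDerivAt f f' t) :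
    HasDerivAt (fun t => (f t).re) f'.re t := reCLM.hasFDerivAt.comp_hasDerivAt t h

theorem HasDerivAt.complex_im {f : ℝ → ℂ} {f' : ℂ} {t : ℝ} (h : HasDerivAt f f' t) :
    HasDerivAt (fun t => (f t).im) f'.im t := imCLM.hasFDerivAt.comp_hasDerivAt t h

/-! ### The Reeb field of a torus-invariant boundary -/

section Reeb

variable {X : Set (ℂ × ℂ)} {R : ℂ × ℂ → ℂ × ℂ} {p : ℂ × ℂ}

local notation "fstL" => ContinuousLinearMap.fst ℝ ℂ ℂ
local notation "sndL" => ContinuousLinearMap.snd ℝ ℂ ℂ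

/-- The rotation directions `(i z₁, 0)` and `(0, i z₂)` are tangent, and `dλ₀(R, ·)` on them gives
exactly these real parts. -/
theorem IsReebField.re_eq_zero (hR : IsReebField X liouvilleForm R) (hX : IsClosed X)
    (hT : IsTorusInvariant X) (hp : p ∈ frontier X) :
    (conj p.1 * (R p).1).re = 0 ∧ (conj p.2 * (R p).2).re = 0 := by
  have h1 := hR.kernel p hp _ (hT.isTangent_rotation hX hp 1 0)
  have h2 := hR.kernel p hp _ (hT.isTangent_rotation hX hp 0 1)
  rw [dOneForm_liouvilleForm] at h1 h2
  simp at h1 h2 ⊢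
  constructor <;> linarith

theorem IsReebField.fst_eq (hR : IsReebField X liouvilleForm R) (hX : IsClosed X)
    (hT : IsTorusInvariant X) (hp : p ∈ frontier X) (h1 : p.1 ≠ 0) :
    (R p).1 = I * angularSpeed fstL R p * p.1 :=
  eq_angularSpeed_mul (π := fstL) (hR.re_eq_zero hX hT hp).1 h1

theorem IsReebField.snd_eq (hR : IsReebField X liouvilleForm R) (hX : IsClosed X)
    (hT : IsTorusInvariant X) (hp : p ∈ frontier X) (h2 : p.2 ≠ 0) :
    (R p).2 = I * angularSpeed sndL R p * p.2 :=
  eq_angularSpeed_mul (π := sndL) (hR.re_eq_zero hX hT hp).2 h2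

theorem IsReebField.angularSpeed_sum (hR : IsReebField X liouvilleForm R)
    (hp : p ∈ frontier X) (h1 : p.1 ≠ 0) (h2 : p.2 ≠ 0) :
    angularSpeed fstL R p * normSq p.1 + angularSpeed sndL R p * normSq p.2 = 2 := by
  have h := hR.normalized p hp
  rw [liouvilleForm_apply] at h
  have h1' := (normSq_pos.2 h1).ne'
  have h2' := (normSq_pos.2 h2).ne'
  simp only [angularSpeed, ContinuousLinearMap.coe_fst', ContinuousLinearMap.coe_snd']
  rw [div_mul_cancel₀ _ h1', div_mul_cancel₀ _ h2']
  linarith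

theorem IsReebField.tangent_relation (hR : IsReebField X liouvilleForm R) (hX : IsClosed X)
    (hT : IsTorusInvariant X) (hp : p ∈ frontier X) (h1 : p.1 ≠ 0) (h2 : p.2 ≠ 0) {v : ℂ × ℂ}
    (hv : IsTangentToBoundary X p v) :
    angularSpeed fstL R p * (conj p.1 * v.1).re + angularSpeed sndL R p * (conj p.2 * v.2).re
      = 0 := by
  have h := hR.kernel p hp v hv
  rw [dOneForm_liouvilleForm, hR.fst_eq hX hT hp h1, hR.snd_eq hX hT hp h2] at h
  simp at h ⊢
  linarith

theorem IsReebField.rotation (hR : IsReebField X liouvilleForm R)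
    (hc : IsContactFormOnBoundary X liouvilleForm)
    (hT : IsTorusInvariant X) (hp : p ∈ frontier X) (c d : Circle) :
    R (torusRotation c d p) = torusRotation c d (R p) := by
  have hq := (hT.mem_frontier_iff c d p).2 hp
  refine reeb_unique hc hq (hR.vectorField.tangent _ hq)
    (hT.isTangent (hR.vectorField.tangent _ hp)) (hR.normalized _ hq) ?_ (hR.kernel _ hq) ?_
  · have := hR.normalized p hp
    rw [liouvilleForm_apply] at this ⊢
    simpa only [torusRotation_apply, conj_mul_circle_mul] using this
  · intro u hu
    have := hR.kernel p hp _ (hT.isTangent_symm hu)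
    rw [dOneForm_liouvilleForm] at this ⊢
    conv_lhs => rw [← torusRotation_apply_inv c d u]
    rw [torusRotation_apply, torusRotation_apply c d (torusRotation _ _ u)]
    simpa only [conj_mul_circle_mul] using this

theorem normSq_circle_mul (c : Circle) (z : ℂ) : normSq (c * z) = normSq z := by
  simp [normSq_eq_norm_sq, Circle.norm_coe]

theorem IsReebField.angularSpeed_fst_rotation (hR : IsReebField X liouvilleForm R)
    (hc : IsContactFormOnBoundary X liouvilleForm)
    (hT : IsTorusInvariant X) (c d : Circle) (hp : p ∈ frontier X) :
    angularSpeed fstL R (torusRotation c d p) = angularSpeed fstL R p := by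
  rw [angularSpeed, hR.rotation hc hT hp]
  simp only [angularSpeed, ContinuousLinearMap.coe_fst', torusRotation_apply, conj_mul_circle_mul,
    normSq_circle_mul]

/-- The component of `v` transverse to the torus orbit through `z`, suitably normalized. -/
noncomputable def transversePart (z v : ℂ × ℂ) : ℝ :=
  (normSq z.2 * (conj z.1 * v.1).re - normSq z.1 * (conj z.2 * v.2).re) / 2

theorem transversePart_rotation (c d : Circle) (z v : ℂ × ℂ) :
    transversePart (torusRotation c d z) (torusRotation c d v) = transversePart z v := by
  simp only [transversePart, torusRotation_apply, conj_mul_circle_mul, normSq_circle_mul]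

theorem transversePart_sub (z v w : ℂ × ℂ) :
    transversePart z (v - w) = transversePart z v - transversePart z w := by
  simp [transversePart]; ring

theorem transversePart_smul (z v : ℂ × ℂ) (c : ℝ) :
    transversePart z (c • v) = c * transversePart z v := by
  simp [transversePart]; ring

/-- Tangency and the vanishing transverse part are two linear equations for the real parts of `conj
zⱼ vⱼ`. Their determinant is `-(ω₁ |z₁|² + ω₂ |z₂|²) = -2`, so both real parts vanish and `v` is an
orbit direction; `λ₀(v) = 0` leaves one real parameter. -/
theorem IsReebField.eq_of_transversePart_eq_zero (hR : IsReebField X liouvilleForm R)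
    (hX : IsClosed X) (hT : IsTorusInvariant X) (hp : p ∈ frontier X) (h1 : p.1 ≠ 0) (h2 : p.2 ≠ 0)
    {v : ℂ × ℂ} (hv : IsTangentToBoundary X p v) (hlam : liouvilleForm p v = 0)
    (hs : transversePart p v = 0) :
    v = (I * ((conj p.1 * v.1).im / normSq p.1 : ℝ) * p.1,
      I * (-(conj p.1 * v.1).im / normSq p.2 : ℝ) * p.2) := by
  have e1 := hR.tangent_relation hX hT hp h1 h2 hv
  have e2 := hR.angularSpeed_sum hp h1 h2
  rw [transversePart] at hs
  rw [liouvilleForm_apply] at hlam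
  generalize angularSpeed fstL R p = a at *
  generalize angularSpeed sndL R p = b at *
  have r1 : (conj p.1 * v.1).re = 0 := by
    linear_combination -(conj p.1 * v.1).re / 2 * e2 + normSq p.1 / 2 * e1 + b * hs
  have r2 : (conj p.2 * v.2).re = 0 := by
    linear_combination -(conj p.2 * v.2).re / 2 * e2 + normSq p.2 / 2 * e1 - a * hs
  rw [show -(conj p.1 * v.1).im = (conj p.2 * v.2).im by linarith]
  exact Prod.ext (eq_rotation_of_conj_mul_re h1 r1) (eq_rotation_of_conj_mul_re h2 r2)

end Reeb

/-! ### The angular speed does not vary across the tori -/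

section Shear

variable {X : Set (ℂ × ℂ)} {R X₁ X₂ : ℂ × ℂ → ℂ × ℂ} {P Q K : ℂ × ℂ → ℝ} {p : ℂ × ℂ}

local notation "fstL" => ContinuousLinearMap.fst ℝ ℂ ℂ
local notation "sndL" => ContinuousLinearMap.snd ℝ ℂ ℂ

theorem IsContactCanonicalFrame.transversePart_ne_zero
    (hF : IsContactCanonicalFrame X liouvilleForm R X₁ X₂ P Q K) (hX : IsClosed X)
    (hT : IsTorusInvariant X) (hp : p ∈ frontier X) (h1 : p.1 ≠ 0) (h2 : p.2 ≠ 0) :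
    transversePart p (X₁ p) ≠ 0 ∨ transversePart p (X₂ p) ≠ 0 := by
  by_contra! h
  have e1 := hF.reeb.eq_of_transversePart_eq_zero hX hT hp h1 h2 (hF.vectorField₁.tangent p hp)
    (hF.mem_contact₁ p hp) h.1
  have e2 := hF.reeb.eq_of_transversePart_eq_zero hX hT hp h1 h2 (hF.vectorField₂.tangent p hp)
    (hF.mem_contact₂ p hp) h.2
  have hli := Fintype.linearIndependent_iff.1 (hF.linearIndependent p hp)
  generalize (conj p.1 * (X₁ p).1).im = a at *
  generalize (conj p.1 * (X₂ p).1).im = b at *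
  -- Both contact fields would be multiples, by `a` and `b`, of one and the same orbit direction.
  have h3 := hli ![0, b, -a] (by
    simp only [Fin.sum_univ_three, Matrix.cons_val_zero, Matrix.cons_val_one, Matrix.cons_val]
    rw [e1, e2]
    ext1 <;> simp <;> ring)
  have ha : a = 0 := by simpa using h3 2
  have h4 := hli ![0, 1, 0] (by
    simp only [Fin.sum_univ_three, Matrix.cons_val_zero, Matrix.cons_val_one, Matrix.cons_val]
    rw [e1, ha]
    simp)
  simpa using h4 1

/-- On the contact plane the differential of an invariant function kills the kernel of the
transverse part, hence is a multiple of it; `w` serves to name the factor. -/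
theorem IsReebField.fderiv_eq_mul_transversePart (hR : IsReebField X liouvilleForm R)
    (hX : IsClosed X) (hT : IsTorusInvariant X) (hp : p ∈ frontier X) (h1 : p.1 ≠ 0) (h2 : p.2 ≠ 0)
    {f : ℂ × ℂ → ℝ} (hf : ∀ (c d : Circle), ∀ q ∈ frontier X, f (torusRotation c d q) = f q)
    (hfp : ContDiffAt ℝ ∞ f p) {w : ℂ × ℂ} (hw : IsTangentToBoundary X p w)
    (hw0 : liouvilleForm p w = 0) (hws : transversePart p w ≠ 0)
    {v : ℂ × ℂ} (hv : IsTangentToBoundary X p v) (hv0 : liouvilleForm p v = 0) :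
    fderiv ℝ f p v = fderiv ℝ f p w / transversePart p w * transversePart p v := by
  have hu := hR.eq_of_transversePart_eq_zero hX hT hp h1 h2
    ((hv.smul (transversePart p w)).sub (hw.smul (transversePart p v)))
    (by simp [hv0, hw0]) (by rw [transversePart_sub, transversePart_smul, transversePart_smul]; ring)
  have h := fderiv_orbit_of_invariant hp hf hfp
  have h3 := congrArg (fderiv ℝ f p) hu
  rw [h, map_sub, map_smul, map_smul, smul_eq_mul, smul_eq_mul] at h3
  field_simp
  linarith

theorem IsReebField.hasDerivAt_torusOrbit (hR : IsReebField X liouvilleForm R)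
    (hX : IsClosed X) (hT : IsTorusInvariant X) (hc : IsContactFormOnBoundary X liouvilleForm)
    (hp : p ∈ frontier X) (h1 : p.1 ≠ 0) (h2 : p.2 ≠ 0) (t : ℝ) :
    HasDerivAt (torusOrbit (angularSpeed fstL R p) (angularSpeed sndL R p) p)
      (R (torusOrbit (angularSpeed fstL R p) (angularSpeed sndL R p) p t)) t := by
  have h := _root_.hasDerivAt_torusOrbit (angularSpeed fstL R p) (angularSpeed sndL R p) p t
  refine h.congr_deriv ?_
  have hRp : R p = (I * angularSpeed fstL R p * p.1, I * angularSpeed sndL R p * p.2) :=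
    Prod.ext (hR.fst_eq hX hT hp h1) (hR.snd_eq hX hT hp h2)
  conv_rhs => rw [torusOrbit, hR.rotation hc hT hp, hRp]
  ext1 <;> simp only [torusOrbit, torusRotation_apply] <;> ring

/-- The derivative of the transverse part and of the angular part of a vector field `Y` on the
boundary along a Reeb orbit, in terms of the bracket `W` of the Reeb field with `Y`. -/
theorem IsReebField.hasDerivAt_parts (hR : IsReebField X liouvilleForm R)
    (hX : IsClosed X) (hs : HasSmoothBoundary X) (hT : IsTorusInvariant X)
    (hc : IsContactFormOnBoundary X liouvilleForm)
    (hp : p ∈ frontier X) (h1 : p.1 ≠ 0) (h2 : p.2 ≠ 0) {Y W : ℂ × ℂ → ℂ × ℂ}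
    (hY : IsBoundaryVectorField X Y)
    (hbr : ∀ q ∈ frontier X, fderiv ℝ Y q (R q) = fderiv ℝ R q (Y q) + W q) (t : ℝ)
    {γ : ℝ → ℂ × ℂ} (hγ : γ = torusOrbit (angularSpeed fstL R p) (angularSpeed sndL R p) p) :
    HasDerivAt (fun t => transversePart (γ t) (Y (γ t))) (transversePart (γ t) (W (γ t))) t ∧
    HasDerivAt (fun t => (conj (γ t).1 * (Y (γ t)).1).im)
      ((conj (γ t).1 * (W (γ t)).1).im +
        normSq p.1 * fderiv ℝ (angularSpeed fstL R) (γ t) (Y (γ t))) t := by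
  have hd : HasDerivAt γ (R (γ t)) t := by
    rw [hγ]; exact hR.hasDerivAt_torusOrbit hX hT hc hp h1 h2 t
  have hn1 : ∀ t, normSq (γ t).1 = normSq p.1 := fun t => by
    simp [hγ, torusOrbit, normSq_circle_mul, -Circle.coe_exp]
  have hn2 : ∀ t, normSq (γ t).2 = normSq p.2 := fun t => by
    simp [hγ, torusOrbit, normSq_circle_mul, -Circle.coe_exp]
  have hq : γ t ∈ frontier X := by rw [hγ]; exact hT.torusOrbit_mem hp _ _ _
  have hq1 : (γ t).1 ≠ 0 := by rw [← normSq_pos, hn1]; exact normSq_pos.2 h1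
  have hq2 : (γ t).2 ≠ 0 := by rw [← normSq_pos, hn2]; exact normSq_pos.2 h2
  have hRq := hR.vectorField.smooth _ hq
  have hYt := hY.tangent _ hq
  have hYd := (hY.smooth _ hq).differentiableAt (by simp)
  have c1 : ∀ᶠ q in 𝓝 (γ t), q ∈ frontier X → fstL (R q) = I * angularSpeed fstL R q * fstL q := by
    filter_upwards [continuous_fst.continuousAt.eventually_ne hq1] with q h3 h4
      using hR.fst_eq hX hT h4 h3
  have c2 : ∀ᶠ q in 𝓝 (γ t), q ∈ frontier X → sndL (R q) = I * angularSpeed sndL R q * sndL q := by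
    filter_upwards [continuous_snd.continuousAt.eventually_ne hq2] with q h3 h4
      using hR.snd_eq hX hT h4 h3
  have d1 := hYt.fderiv_rotating hX hs hq hRq fstL (contDiffAt_angularSpeed fstL hRq hq1) c1
  have d2 := hYt.fderiv_rotating hX hs hq hRq sndL (contDiffAt_angularSpeed sndL hRq hq2) c2
  have f1 := hasDerivAt_conj_mul_comp fstL hd (c1.self_of_nhds hq) d1 hYd (hbr _ hq)
  have f2 := hasDerivAt_conj_mul_comp sndL hd (c2.self_of_nhds hq) d2 hYd (hbr _ hq)
  simp only [ContinuousLinearMap.coe_fst', ContinuousLinearMap.coe_snd'] at f1 f2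
  constructor
  · have := ((f1.complex_re.const_mul (normSq p.2)).sub
      (f2.complex_re.const_mul (normSq p.1))).div_const 2
    simp only [transversePart, hn1, hn2]
    refine HasDerivAt.congr_deriv this ?_
    simp
  · refine f1.complex_im.congr_deriv ?_
    simp [hn1]
    ring

theorem IsContactCanonicalFrame.fderiv_angularSpeed_eq_zero
    (hF : IsContactCanonicalFrame X liouvilleForm R X₁ X₂ P Q K)
    (hK : ∀ q ∈ frontier X, K q = 1) (hX : IsCompact X) (hs : HasSmoothBoundary X)
    (hT : IsTorusInvariant X) (hp : p ∈ frontier X) (h1 : p.1 ≠ 0) (h2 : p.2 ≠ 0)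
    {v : ℂ × ℂ} (hv : IsTangentToBoundary X p v) : fderiv ℝ (angularSpeed fstL R) p v = 0 := by
  have hXc := hX.isClosed
  have hR := hF.reeb
  have hc := hF.contact
  have hinv : ∀ (c d : Circle), ∀ q ∈ frontier X,
      angularSpeed fstL R (torusRotation c d q) = angularSpeed fstL R q :=
    fun c d q hq => hR.angularSpeed_fst_rotation hc hT c d hq
  have hfp := contDiffAt_angularSpeed fstL (hR.vectorField.smooth p hp) h1
  have br1 : ∀ q ∈ frontier X, fderiv ℝ X₁ q (R q) = fderiv ℝ R q (X₁ q) + X₂ q := by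
    intro q hq
    have := hF.bracket_R_X₁ q hq
    rw [hK q hq, one_smul, VectorField.lieBracket] at this
    rw [← this]; abel
  have br2 : ∀ q ∈ frontier X, fderiv ℝ X₂ q (R q) = fderiv ℝ R q (X₂ q) + (-X₁) q := by
    intro q hq
    have := hF.bracket_X₂_R q hq
    rw [VectorField.lieBracket] at this
    rw [Pi.neg_apply, ← this]; abel
  obtain ⟨c, hcv⟩ : ∃ c, ∀ v, IsTangentToBoundary X p v → liouvilleForm p v = 0 →
      fderiv ℝ (angularSpeed fstL R) p v = c * transversePart p v := by
    rcases hF.transversePart_ne_zero hXc hT hp h1 h2 with h | h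
    · exact ⟨_, fun v hv hv0 => hR.fderiv_eq_mul_transversePart hXc hT hp h1 h2 hinv hfp
        (hF.vectorField₁.tangent p hp) (hF.mem_contact₁ p hp) h hv hv0⟩
    · exact ⟨_, fun v hv hv0 => hR.fderiv_eq_mul_transversePart hXc hT hp h1 h2 hinv hfp
        (hF.vectorField₂.tangent p hp) (hF.mem_contact₂ p hp) h hv hv0⟩
  set γ := torusOrbit (angularSpeed fstL R p) (angularSpeed sndL R p) p with hγ
  have hγm : ∀ t, γ t ∈ frontier X := fun t => hT.torusOrbit_mem hp _ _ t
  -- The orbit moves by rotations, which preserve the angular speed, the transverse part and `λ₀`;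
  -- so the factor `c` found at `p` serves along the whole orbit.
  have hcγ : ∀ t v, IsTangentToBoundary X (γ t) v → liouvilleForm (γ t) v = 0 →
      fderiv ℝ (angularSpeed fstL R) (γ t) v = c * transversePart (γ t) v := by
    intro t v hv hv0
    have hv' := hT.isTangent_symm hv
    have hq1 : (γ t).1 ≠ 0 := by simp [hγ, torusOrbit, h1]
    have e := fderiv_rotation_of_invariant hXc hs hp hinv
      (Circle.exp (angularSpeed fstL R p * t)) (Circle.exp (angularSpeed sndL R p * t)) hfp
      (contDiffAt_angularSpeed fstL (hR.vectorField.smooth _ (hγm t)) hq1) hv'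
    rw [torusRotation_apply_inv] at e
    have e' := transversePart_rotation (Circle.exp (angularSpeed fstL R p * t))
      (Circle.exp (angularSpeed sndL R p * t)) p
      (torusRotation (Circle.exp (angularSpeed fstL R p * t))⁻¹
        (Circle.exp (angularSpeed sndL R p * t))⁻¹ v)
    rw [torusRotation_apply_inv] at e'
    refine e.trans ((hcv _ hv' ?_).trans (congrArg _ e'.symm))
    rw [liouvilleForm_apply] at hv0 ⊢
    rw [← torusRotation_apply_inv (Circle.exp (angularSpeed fstL R p * t))
      (Circle.exp (angularSpeed sndL R p * t)) v] at hv0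
    simp only [hγ, torusOrbit] at hv0
    rw [torusRotation_apply, torusRotation_apply _ _ (torusRotation _ _ v)] at hv0
    simpa only [conj_mul_circle_mul] using hv0
  have D1 := fun t => hR.hasDerivAt_parts hXc hs hT hc hp h1 h2 hF.vectorField₁ br1 t hγ
  have D2 := fun t => hR.hasDerivAt_parts hXc hs hT hc hp h1 h2 hF.vectorField₂ br2 t hγ
  have k1 := fun t => hcγ t _ (hF.vectorField₁.tangent _ (hγm t)) (hF.mem_contact₁ _ (hγm t))
  have k2 := fun t => hcγ t _ (hF.vectorField₂.tangent _ (hγm t)) (hF.mem_contact₂ _ (hγm t))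
  simp only [k1] at D1
  simp only [k2] at D2
  set s₁ : ℝ → ℝ := fun t => transversePart (γ t) (X₁ (γ t)) with hs₁
  set s₂ : ℝ → ℝ := fun t => transversePart (γ t) (X₂ (γ t)) with hs₂
  set a₁ : ℝ → ℝ := fun t => (conj (γ t).1 * (X₁ (γ t)).1).im with ha₁
  set a₂ : ℝ → ℝ := fun t => (conj (γ t).1 * (X₂ (γ t)).1).im with ha₂
  have E1 : ∀ t, HasDerivAt s₁ (s₂ t) t := fun t => (D1 t).1
  have E2 : ∀ t, HasDerivAt s₂ (-s₁ t) t := fun t => (D2 t).1.congr_deriv (by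
    simp [hs₁, transversePart]; ring)
  have E3 : ∀ t, HasDerivAt a₁ (a₂ t + normSq p.1 * (c * s₁ t)) t := fun t => (D1 t).2
  have E4 : ∀ t, HasDerivAt a₂ (-a₁ t + normSq p.1 * (c * s₂ t)) t := fun t =>
    (D2 t).2.congr_deriv (by
      simp only [ha₁, hs₂, Pi.neg_apply, Prod.fst_neg, mul_neg, neg_im])
  have hN : ∀ t, s₁ t ^ 2 + s₂ t ^ 2 = s₁ 0 ^ 2 + s₂ 0 ^ 2 := by
    have h : ∀ t, HasDerivAt (fun t => s₁ t ^ 2 + s₂ t ^ 2) 0 t := fun t =>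
      (((E1 t).pow 2).add ((E2 t).pow 2)).congr_deriv (by simp; ring)
    intro t
    exact is_const_of_deriv_eq_zero (fun t => (h t).differentiableAt) (fun t => (h t).deriv) t 0
  set N := s₁ 0 ^ 2 + s₂ 0 ^ 2 with hNdef
  -- The common rotation of `(s₁, s₂)` and `(a₁, a₂)` cancels in their inner product. Only the shear
  -- remains, and it makes the product affine in `t`.
  have hG : ∀ t, s₁ t * a₁ t + s₂ t * a₂ t =
      s₁ 0 * a₁ 0 + s₂ 0 * a₂ 0 + normSq p.1 * c * N * t := by
    have h : ∀ t, HasDerivAt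
        (fun t => s₁ t * a₁ t + s₂ t * a₂ t - normSq p.1 * c * N * t) 0 t := fun t => by
      refine ((((E1 t).mul (E3 t)).add ((E2 t).mul (E4 t))).sub
        ((hasDerivAt_id t).const_mul (normSq p.1 * c * N))).congr_deriv ?_
      rw [← hN t]; ring
    intro t
    have := is_const_of_deriv_eq_zero (fun t => (h t).differentiableAt) (fun t => (h t).deriv) t 0
    linarith
  have hfrc : IsCompact (frontier X) := hX.of_isClosed_subset isClosed_frontier hXc.frontier_subset
  have hcont : ContinuousOn (fun z => transversePart z (X₁ z) * (conj z.1 * (X₁ z).1).im +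
      transversePart z (X₂ z) * (conj z.1 * (X₂ z).1).im) (frontier X) := by
    intro z hz
    have g1 := (hF.vectorField₁.smooth z hz).continuousAt
    have g2 := (hF.vectorField₂.smooth z hz).continuousAt
    refine ContinuousAt.continuousWithinAt ?_
    simp only [transversePart, normSq_apply]
    fun_prop
  obtain ⟨C, hC⟩ := hfrc.exists_bound_of_continuousOn hcont
  have hbd : ∀ t, |s₁ 0 * a₁ 0 + s₂ 0 * a₂ 0 + normSq p.1 * c * N * t| ≤ C := fun t => by
    rw [← hG t]; exact hC _ (hγm t)
  have hNpos : 0 < N := by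
    have := hF.transversePart_ne_zero hXc hT hp h1 h2
    have e1 : s₁ 0 = transversePart p (X₁ p) := by simp [hs₁, hγ]
    have e2 : s₂ 0 = transversePart p (X₂ p) := by simp [hs₂, hγ]
    rw [← e1, ← e2] at this
    rcases this with h | h
    · have := sq_pos_of_ne_zero h
      positivity
    · have := sq_pos_of_ne_zero h
      positivity
  have hc0 : c = 0 := by
    by_contra hc0
    have hm : normSq p.1 * c * N ≠ 0 := mul_ne_zero (mul_ne_zero (normSq_pos.2 h1).ne' hc0) hNpos.ne'
    -- The time at which the affine function takes the value `C + 1`.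
    have := hbd ((C + 1 - (s₁ 0 * a₁ 0 + s₂ 0 * a₂ 0)) / (normSq p.1 * c * N))
    rw [mul_div_cancel₀ _ hm] at this
    have := (le_abs_self _).trans this
    linarith
  have hRt := hR.vectorField.tangent p hp
  -- A general tangent vector is reduced to the contact plane by removing its Reeb component, along
  -- which the angular speed is constant.
  have h := hcv (v - liouvilleForm p v • R p) (hv.sub (hRt.smul _))
    (by simp [hR.normalized p hp])
  have hRp : R p = (I * angularSpeed fstL R p * p.1, I * angularSpeed sndL R p * p.2) :=
    Prod.ext (hR.fst_eq hXc hT hp h1) (hR.snd_eq hXc hT hp h2)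
  have h0 : fderiv ℝ (angularSpeed fstL R) p (R p) = 0 := by
    conv_lhs => rw [hRp]
    exact fderiv_orbit_of_invariant hp hinv hfp _ _
  rw [hc0, zero_mul, map_sub, map_smul, h0, smul_zero, sub_zero] at h
  exact h

end Shear

/-! ### Constant angular speeds force an ellipsoid -/

section Rigidity

variable {X : Set (ℂ × ℂ)} {R X₁ X₂ : ℂ × ℂ → ℂ × ℂ} {P Q K : ℂ × ℂ → ℝ} {p : ℂ × ℂ}

local notation "fstL" => ContinuousLinearMap.fst ℝ ℂ ℂ
local notation "sndL" => ContinuousLinearMap.snd ℝ ℂ ℂ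

/-- Radial transversality lets the implicit function theorem solve `g (t d(x)) = 0` for `t`; since a
ray meets the boundary only once, the solution coincides with `r`. -/
theorem differentiableAt_radial_function (hX : IsClosed X) (hs : HasSmoothBoundary X)
    (hc : IsContactFormOnBoundary X liouvilleForm) (h0 : (0 : ℂ × ℂ) ∈ interior X)
    (hstar : ∀ z ∈ X, ∀ t : ℝ, 0 ≤ t → t ≤ 1 → t • z ∈ X)
    {d : ℝ → ℂ × ℂ} (hd : ContDiff ℝ ∞ d) {r : ℝ → ℝ} (hr : ∀ x, 0 < r x)
    (hrd : ∀ x, r x • d x ∈ frontier X) (x₀ : ℝ) : DifferentiableAt ℝ r x₀ := by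
  obtain ⟨g, hg⟩ := hs _ (hrd x₀)
  set F : ℝ × ℝ → ℝ := fun u => g (u.2 • d u.1) with hF
  have hFc : ContDiff ℝ ∞ F := hg.smooth.comp (contDiff_snd.smul (hd.comp contDiff_fst))
  have hFd : ContDiffAt ℝ ∞ F (x₀, r x₀) := hFc.contDiffAt
  have hpos : 0 < fderiv ℝ g (r x₀ • d x₀) (d x₀) := by
    have := hg.radial_pos hX hc h0 hstar (hrd x₀)
    rw [map_smul, smul_eq_mul] at this
    exact (mul_pos_iff_of_pos_left (hr x₀)).1 this
  have hinr : ∀ s : ℝ, (fderiv ℝ F (x₀, r x₀) ∘L .inr ℝ ℝ ℝ) s =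
      s * fderiv ℝ g (r x₀ • d x₀) (d x₀) := by
    have h1 : HasDerivAt (fun t : ℝ => F (x₀, t)) (fderiv ℝ F (x₀, r x₀) (0, 1)) (r x₀) :=
      ((hFd.differentiableAt (by simp)).hasFDerivAt).comp_hasDerivAt (r x₀)
        ((hasDerivAt_const (r x₀) x₀).prodMk (hasDerivAt_id _))
    have h2 : HasDerivAt (fun t : ℝ => F (x₀, t)) (fderiv ℝ g (r x₀ • d x₀) (d x₀)) (r x₀) := by
      have h3 : HasDerivAt (fun t : ℝ => t • d x₀) (d x₀) (r x₀) := by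
        simpa using (hasDerivAt_id (r x₀)).smul_const (d x₀)
      exact (hg.hasFDerivAt _).comp_hasDerivAt (r x₀) h3
    intro s
    rw [← h1.unique h2]
    rw [ContinuousLinearMap.comp_apply, ContinuousLinearMap.inr_apply, ← smul_eq_mul, ← map_smul]
    simp
  have hinv : (fderiv ℝ F (x₀, r x₀) ∘L .inr ℝ ℝ ℝ).IsInvertible :=
    ⟨ContinuousLinearEquiv.unitsEquivAut ℝ (Units.mk0 _ hpos.ne'), by
      ext
      rw [hinr]
      simp⟩
  have hst := hFd.hasStrictFDerivAt (n := ∞) (by simp)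
  set ψ := hst.implicitFunctionOfProdDomain hinv with hψ
  have hψd : DifferentiableAt ℝ ψ x₀ :=
    (hst.hasStrictFDerivAt_implicitFunctionOfProdDomain hinv).hasFDerivAt.differentiableAt
  have hψt : Tendsto ψ (𝓝 x₀) (𝓝 (r x₀)) := hst.tendsto_implicitFunctionOfProdDomain hinv
  have hψ0 : ∀ᶠ x in 𝓝 x₀, F (x, ψ x) = F (x₀, r x₀) :=
    hst.eventually_apply_implicitFunctionOfProdDomain hinv
  have hlim : Tendsto (fun x => ψ x • d x) (𝓝 x₀) (𝓝 (r x₀ • d x₀)) :=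
    hψt.smul hd.continuous.continuousAt
  refine hψd.congr_of_eventuallyEq ?_
  filter_upwards [hψ0, hψt.eventually (lt_mem_nhds (hr x₀)),
    hlim.eventually hg.eventually_mem_frontier] with x h1 h2 h3
  have h4 : ψ x • d x ∈ frontier X := h3 (h1.trans (hg.apply_eq_zero hX (hrd x₀)))
  have h5 : (ψ x / r x) • (r x • d x) ∈ frontier X := by
    rwa [smul_smul, div_mul_cancel₀ _ (hr x).ne']
  have h6 := eq_one_of_smul_mem_frontier hX hs hc h0 hstar (hrd x) h5 (div_pos h2 (hr x))
  rw [div_eq_one_iff_eq (hr x).ne'] at h6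
  exact h6.symm

theorem exists_rotation_norm (z : ℂ × ℂ) :
    ∃ c d : Circle, torusRotation c d ((‖z.1‖ : ℂ), (‖z.2‖ : ℂ)) = z := by
  refine ⟨Circle.exp (arg z.1), Circle.exp (arg z.2), ?_⟩
  rw [torusRotation_apply, Circle.coe_exp, Circle.coe_exp, mul_comm, norm_mul_exp_arg_mul_I,
    mul_comm, norm_mul_exp_arg_mul_I]

theorem HasDerivAt.normSq {f : ℝ → ℂ} {f' : ℂ} {t : ℝ} (h : HasDerivAt f f' t) :
    HasDerivAt (fun t => Complex.normSq (f t)) (2 * (conj (f t) * f').re) t := by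
  have h1 := (h.complex_re.mul h.complex_re).add (h.complex_im.mul h.complex_im)
  simp only [normSq_apply]
  refine HasDerivAt.congr_deriv h1 ?_
  simp; ring

theorem IsContactCanonicalFrame.exists_ellipsoid
    (hF : IsContactCanonicalFrame X liouvilleForm R X₁ X₂ P Q K)
    (hK : ∀ q ∈ frontier X, K q = 1) (hX : IsCompact X) (hs : HasSmoothBoundary X)
    (hT : IsTorusInvariant X) (h0 : (0 : ℂ × ℂ) ∈ interior X)
    (hstar : ∀ z ∈ X, ∀ t : ℝ, 0 ≤ t → t ≤ 1 → t • z ∈ X) :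
    ∃ a b : ℝ, 0 < a ∧ 0 < b ∧ X = {z | a * normSq z.1 + b * normSq z.2 ≤ 2} := by
  have hXc := hX.isClosed
  have hR := hF.reeb
  have hc := hF.contact
  -- For `x` in `[0, 1]` these directions represent all nonzero points up to rotation and positive
  -- scaling; the curve never passes through `0`.
  set d : ℝ → ℂ × ℂ := fun x => (((1 - x : ℝ) : ℂ), (x : ℂ)) with hd
  have hdd : ContDiff ℝ ∞ d :=
    (ofRealCLM.contDiff.comp (contDiff_const.sub contDiff_id)).prodMk ofRealCLM.contDiff
  have hd0 : ∀ x, d x ≠ 0 := by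
    intro x h
    have h1 : x = 0 := by simpa [hd] using congrArg Prod.snd h
    have h2 := congrArg Prod.fst h
    simp [hd, h1] at h2
  choose r hr hrf using fun x => exists_smul_mem_frontier hX hT h0 (hd0 x)
  have hrd := differentiableAt_radial_function hXc hs hc h0 hstar hdd hr hrf
  set γ : ℝ → ℂ × ℂ := fun x => r x • d x with hγ
  have hγd : ∀ x, HasDerivAt γ (deriv γ x) x := fun x =>
    ((hrd x).smul ((hdd.differentiable (by simp)).differentiableAt)).hasDerivAt
  have hγt : ∀ x, IsTangentToBoundary X (γ x) (deriv γ x) := fun x =>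
    isTangentToBoundary_of_hasDerivAt hXc (hγd x) (Eventually.of_forall hrf)
  have hγ1 : ∀ x ∈ Ioo (0 : ℝ) 1, (γ x).1 ≠ 0 := fun x hx => by
    have h1 : (1 : ℝ) - x ≠ 0 := by linarith [hx.2]
    have h2 : ((1 : ℂ) - x) ≠ 0 := by exact_mod_cast h1
    simp [hγ, hd, (hr x).ne', h2]
  have hγ2 : ∀ x ∈ Ioo (0 : ℝ) 1, (γ x).2 ≠ 0 := fun x hx => by
    simp [hγ, hd, (hr x).ne', hx.1.ne']
  have hn1 : ∀ x, HasDerivAt (fun x => normSq (γ x).1)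
      (2 * (conj (γ x).1 * (deriv γ x).1).re) x := fun x =>
    HasDerivAt.normSq ((fstL).hasFDerivAt.comp_hasDerivAt x (hγd x))
  have hn2 : ∀ x, HasDerivAt (fun x => normSq (γ x).2)
      (2 * (conj (γ x).2 * (deriv γ x).2).re) x := fun x =>
    HasDerivAt.normSq ((sndL).hasFDerivAt.comp_hasDerivAt x (hγd x))
  have hw1 : ∀ x ∈ Ioo (0 : ℝ) 1, HasDerivAt (fun x => angularSpeed fstL R (γ x)) 0 x :=
    fun x hx => by
      have h := ((contDiffAt_angularSpeed fstL (hR.vectorField.smooth _ (hrf x))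
        (hγ1 x hx)).differentiableAt (by simp)).hasFDerivAt.comp_hasDerivAt x (hγd x)
      exact h.congr_deriv (hF.fderiv_angularSpeed_eq_zero hK hX hs hT (hrf x) (hγ1 x hx)
        (hγ2 x hx) (hγt x))
  obtain ⟨a, ha⟩ : ∃ a, ∀ x ∈ Ioo (0 : ℝ) 1, angularSpeed fstL R (γ x) = a :=
    isOpen_Ioo.exists_is_const_of_deriv_eq_zero isPreconnected_Ioo
      (fun x hx => (hw1 x hx).differentiableAt.differentiableWithinAt)
      (fun x hx => (hw1 x hx).deriv)
  have hb2 : ∀ x ∈ Ioo (0 : ℝ) 1,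
      angularSpeed sndL R (γ x) = (2 - a * normSq (γ x).1) / normSq (γ x).2 := fun x hx => by
    rw [eq_div_iff (normSq_pos.2 (hγ2 x hx)).ne', ← ha x hx]
    linarith [hR.angularSpeed_sum (hrf x) (hγ1 x hx) (hγ2 x hx)]
  -- Once `ω₁` is constant so is `ω₂`: differentiating `ω₁ |z₁|² + ω₂ |z₂|² = 2` along the curve,
  -- the tangency relation cancels everything but `ω₂' |z₂|²`.
  have hw2 : ∀ x ∈ Ioo (0 : ℝ) 1,
      HasDerivAt (fun x => (2 - a * normSq (γ x).1) / normSq (γ x).2) 0 x := fun x hx => by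
    have hne := (normSq_pos.2 (hγ2 x hx)).ne'
    refine ((((hn1 x).const_mul a).const_sub 2).div (hn2 x) hne).congr_deriv ?_
    have e1 := hR.tangent_relation hXc hT (hrf x) (hγ1 x hx) (hγ2 x hx) (hγt x)
    have e2 := hb2 x hx
    change angularSpeed fstL R (γ x) * _ + angularSpeed sndL R (γ x) * _ = 0 at e1
    rw [eq_div_iff hne] at e2
    rw [ha x hx] at e1
    rw [div_eq_zero_iff]
    left
    linear_combination (-2 * normSq (γ x).2) * e1 + 2 * (conj (γ x).2 * (deriv γ x).2).re * e2
  obtain ⟨b, hb⟩ : ∃ b, ∀ x ∈ Ioo (0 : ℝ) 1, (2 - a * normSq (γ x).1) / normSq (γ x).2 = b :=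
    isOpen_Ioo.exists_is_const_of_deriv_eq_zero isPreconnected_Ioo
      (fun x hx => (hw2 x hx).differentiableAt.differentiableWithinAt)
      (fun x hx => (hw2 x hx).deriv)
  have hQ : ∀ x ∈ Icc (0 : ℝ) 1, a * normSq (γ x).1 + b * normSq (γ x).2 = 2 := by
    have hcl : IsClosed {x : ℝ | a * normSq (γ x).1 + b * normSq (γ x).2 = 2} := by
      refine isClosed_eq ?_ continuous_const
      have c1 : Continuous fun x => normSq (γ x).1 :=
        continuous_iff_continuousAt.2 fun x => (hn1 x).continuousAt
      have c2 : Continuous fun x => normSq (γ x).2 :=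
        continuous_iff_continuousAt.2 fun x => (hn2 x).continuousAt
      fun_prop
    have hsub : Ioo (0 : ℝ) 1 ⊆ {x : ℝ | a * normSq (γ x).1 + b * normSq (γ x).2 = 2} := by
      intro x hx
      have hne := (normSq_pos.2 (hγ2 x hx)).ne'
      have := hb x hx
      rw [div_eq_iff hne] at this
      change _ = _
      linarith
    have := closure_minimal hsub hcl
    rwa [closure_Ioo zero_ne_one] at this
  -- At the ends of the arc one coordinate vanishes, so the quadratic relation isolates one
  -- coefficient.
  have ha0 : 0 < a := by
    have h := hQ 0 (by simp)
    have h2 : a * (r 0 * r 0) = 2 := by simpa [hγ, hd] using h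
    have := mul_pos (hr 0) (hr 0)
    by_contra! hle
    nlinarith
  have hb0 : 0 < b := by
    have h := hQ 1 (by simp)
    have h2 : b * (r 1 * r 1) = 2 := by simpa [hγ, hd] using h
    have := mul_pos (hr 1) (hr 1)
    by_contra! hle
    nlinarith
  -- A boundary point is rotated to the nonnegative real quadrant and rescaled onto the segment `d`;
  -- uniqueness on the ray puts it on the arc.
  have hfr : ∀ q ∈ frontier X, a * normSq q.1 + b * normSq q.2 = 2 := by
    intro q hq
    obtain ⟨c₁, c₂, hcq⟩ := exists_rotation_norm q
    set n := ‖q.1‖ + ‖q.2‖ with hn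
    have hn0 : 0 < n := by
      have := ne_zero_of_mem_frontier h0 hq
      by_contra! hle
      have g1 := norm_nonneg q.1
      have g2 := norm_nonneg q.2
      exact this (Prod.ext (norm_eq_zero.1 (by linarith)) (norm_eq_zero.1 (by linarith)))
    set x := ‖q.2‖ / n with hx
    have hx1 : x ∈ Icc (0 : ℝ) 1 :=
      ⟨by positivity, (div_le_one hn0).2 (by linarith [norm_nonneg q.1])⟩
    have e2 : n * x = ‖q.2‖ := mul_div_cancel₀ _ hn0.ne'
    have e1 : n * (1 - x) = ‖q.1‖ := by rw [mul_sub, e2, hn]; ring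
    have hnd : n • d x = ((‖q.1‖ : ℂ), (‖q.2‖ : ℂ)) := by
      rw [← e1, ← e2]; simp [hd]
    have hm : n • d x ∈ frontier X := by
      rw [hnd, ← hT.mem_frontier_iff c₁ c₂, hcq]; exact hq
    have hm' : (n / r x) • (r x • d x) ∈ frontier X := by
      rwa [smul_smul, div_mul_cancel₀ _ (hr x).ne']
    have h1 := eq_one_of_smul_mem_frontier hXc hs hc h0 hstar (hrf x) hm' (div_pos hn0 (hr x))
    rw [div_eq_one_iff_eq (hr x).ne'] at h1
    have h2 := hQ x hx1
    simp only [hγ, ← h1, hnd] at h2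
    simpa [normSq_eq_norm_sq, sq] using h2
  refine ⟨a, b, ha0, hb0, Set.ext fun z => ?_⟩
  rcases eq_or_ne z 0 with rfl | hz
  · simp [interior_subset h0]
  obtain ⟨s, hs0, hsf⟩ := exists_smul_mem_frontier hX hT h0 hz
  have h2 := hfr _ hsf
  have h3 : s ^ 2 * (a * normSq z.1 + b * normSq z.2) = 2 := by
    rw [← h2]; simp; ring
  have hsz : s⁻¹ • (s • z) = z := by rw [smul_smul, inv_mul_cancel₀ hs0.ne', one_smul]
  change z ∈ X ↔ a * normSq z.1 + b * normSq z.2 ≤ 2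
  constructor
  · intro hzX
    by_contra! hlt
    have hs1 : s < 1 := by
      by_contra! hle
      nlinarith [one_le_pow₀ hle (n := 2)]
    have := smul_notMem hXc hs hc h0 hstar hsf ((one_lt_inv₀ hs0).2 hs1)
    rw [hsz] at this
    exact this hzX
  · intro hle
    have hs1 : 1 ≤ s := by
      by_contra! hlt
      nlinarith [pow_lt_one₀ hs0.le hlt (n := 2) (by simp)]
    rw [← hsz]
    exact hstar _ (hXc.frontier_subset hsf) _ (by positivity) (inv_le_one_of_one_le₀ hs1)

end Rigidity

/-! ### The boundary of an ellipsoid and its Reeb field -/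

section Ellipsoid

variable {a b : ℝ} {p v : ℂ × ℂ}

/-- The ellipsoid `a |z₁|² + b |z₂|² ≤ 2`, whose Reeb flow has frequencies `a` and `b`. -/
def ellipsoid (a b : ℝ) : Set (ℂ × ℂ) := {z | a * normSq z.1 + b * normSq z.2 ≤ 2}

/-- The quadratic defining function of `ellipsoid a b`. -/
noncomputable def ellipsoidFunction (a b : ℝ) (z : ℂ × ℂ) : ℝ :=
  a * normSq z.1 + b * normSq z.2 - 2

theorem contDiff_ellipsoidFunction (a b : ℝ) : ContDiff ℝ ∞ (ellipsoidFunction a b) := by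
  unfold ellipsoidFunction
  simp only [normSq_eq_norm_sq]
  exact (((contDiff_fst.norm_sq ℝ).const_smul a).add
    ((contDiff_snd.norm_sq ℝ).const_smul b)).sub contDiff_const

theorem fderiv_ellipsoidFunction (a b : ℝ) (p v : ℂ × ℂ) :
    fderiv ℝ (ellipsoidFunction a b) p v =
      2 * (a * (conj p.1 * v.1).re + b * (conj p.2 * v.2).re) := by
  have h := hasDerivAt_comp_line (((contDiff_ellipsoidFunction a b).differentiable
    (by simp)).differentiableAt (x := p)).hasFDerivAt v
  have h1 : HasDerivAt (fun t : ℝ => p + t • v) v 0 := by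
    simpa using ((hasDerivAt_id (0 : ℝ)).smul_const v).const_add p
  have h2 := HasDerivAt.normSq
    ((ContinuousLinearMap.fst ℝ ℂ ℂ).hasFDerivAt.comp_hasDerivAt (0 : ℝ) h1)
  have h3 := HasDerivAt.normSq
    ((ContinuousLinearMap.snd ℝ ℂ ℂ).hasFDerivAt.comp_hasDerivAt (0 : ℝ) h1)
  have h4 := (((h2.const_mul a).add (h3.const_mul b)).sub_const 2)
  refine (h.unique h4).trans ?_
  simp
  ring

theorem isClosed_ellipsoid (a b : ℝ) : IsClosed (ellipsoid a b) := by
  have h := (contDiff_ellipsoidFunction a b).continuous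
  have : ellipsoid a b = {z | ellipsoidFunction a b z ≤ 0} := by
    ext z; simp [ellipsoid, ellipsoidFunction]
  rw [this]
  exact isClosed_le h continuous_const

theorem isLocalDefiningFunction_ellipsoidFunction (hp : ellipsoidFunction a b p = 0) :
    IsLocalDefiningFunction (ellipsoid a b) p (ellipsoidFunction a b) where
  smooth := contDiff_ellipsoidFunction a b
  regular := fun h => by
    have h1 := congrArg (fun L : ℂ × ℂ →L[ℝ] ℝ => L p) h
    simp only [fderiv_ellipsoidFunction, ← normSq_eq_conj_mul_self, ofReal_re,
      zero_apply] at h1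
    rw [ellipsoidFunction] at hp
    linarith
  eventually_mem_iff := Eventually.of_forall fun q => by
    simp [ellipsoid, ellipsoidFunction]

theorem mem_frontier_ellipsoid :
    p ∈ frontier (ellipsoid a b) ↔ a * normSq p.1 + b * normSq p.2 = 2 := by
  constructor
  · intro h
    have h1 : (ellipsoid a b) = {z | ellipsoidFunction a b z ≤ 0} := by
      ext z; simp [ellipsoid, ellipsoidFunction]
    rw [h1] at h
    have := frontier_le_subset_eq (contDiff_ellipsoidFunction a b).continuous continuous_const h
    change ellipsoidFunction a b p = 0 at this
    rw [ellipsoidFunction] at this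
    linarith
  · intro h
    have h0 : ellipsoidFunction a b p = 0 := by rw [ellipsoidFunction]; linarith
    exact (isLocalDefiningFunction_ellipsoidFunction h0).eventually_mem_frontier.self_of_nhds h0

theorem ellipsoidFunction_eq_zero (hp : p ∈ frontier (ellipsoid a b)) :
    ellipsoidFunction a b p = 0 := by
  have := mem_frontier_ellipsoid.1 hp
  rw [ellipsoidFunction]; linarith

theorem hasSmoothBoundary_ellipsoid : HasSmoothBoundary (ellipsoid a b) := fun _ hp =>
  ⟨_, isLocalDefiningFunction_ellipsoidFunction (ellipsoidFunction_eq_zero hp)⟩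

theorem isTangentToBoundary_ellipsoid (hp : p ∈ frontier (ellipsoid a b)) :
    IsTangentToBoundary (ellipsoid a b) p v ↔
      a * (conj p.1 * v.1).re + b * (conj p.2 * v.2).re = 0 := by
  rw [(isLocalDefiningFunction_ellipsoidFunction (ellipsoidFunction_eq_zero hp)).isTangent_iff
    (isClosed_ellipsoid a b) hp, fderiv_ellipsoidFunction]
  constructor <;> intro h <;> linarith

/-- The linear vector field generating the rotation with frequencies `a` and `b`. -/
noncomputable def rotationField (a b : ℝ) : ℂ × ℂ →L[ℝ] ℂ × ℂ :=
  ((I * a) • (1 : ℂ →L[ℝ] ℂ)).prodMap ((I * b) • (1 : ℂ →L[ℝ] ℂ))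

@[simp]
theorem rotationField_apply (a b : ℝ) (z : ℂ × ℂ) :
    rotationField a b z = (I * a * z.1, I * b * z.2) := by
  ext <;> simp [rotationField]

theorem isReebField_rotationField (a b : ℝ) :
    IsReebField (ellipsoid a b) liouvilleForm (rotationField a b) where
  vectorField :=
    { smooth := fun _ _ => (rotationField a b).contDiff.contDiffAt
      tangent := fun p hp => by
        rw [isTangentToBoundary_ellipsoid hp]
        simp
        ring }
  normalized := fun p hp => by
    have h := mem_frontier_ellipsoid.1 hp
    rw [normSq_apply, normSq_apply] at h
    simp [liouvilleForm_apply]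
    linarith
  kernel := fun p hp v hv => by
    rw [isTangentToBoundary_ellipsoid hp] at hv
    rw [dOneForm_liouvilleForm]
    simp at hv ⊢
    linarith

end Ellipsoid

/-! ### The complex determinant on contact planes and a winding argument -/

/-- The standard complex area form of `ℂ²`. -/
noncomputable def areaForm (z v : ℂ × ℂ) : ℂ := z.1 * v.2 - z.2 * v.1

/-- By Lagrange's identity `|z|² ⟨v, w⟩ = ⟨v, z⟩ ⟨z, w⟩ + conj (areaForm z v) * areaForm z w` for
the Hermitian product, and the first summand is real when `λ₀` kills `v` and `w`. So `areaForm`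
carries the orientation of the contact plane to that of `ℂ`. -/
theorem im_conj_areaForm_mul {z v w : ℂ × ℂ} (hv : liouvilleForm z v = 0)
    (hw : liouvilleForm z w = 0) : (conj (areaForm z v) * areaForm z w).im =
      (normSq z.1 + normSq z.2) * dOneForm liouvilleForm z v w := by
  rw [liouvilleForm_apply] at hv hw
  rw [dOneForm_liouvilleForm]
  simp [areaForm, normSq_apply] at hv hw ⊢
  have hv' : z.1.re * v.1.im - z.1.im * v.1.re + (z.2.re * v.2.im - z.2.im * v.2.re) = 0 := by
    linarith
  have hw' : z.1.re * w.1.im - z.1.im * w.1.re + (z.2.re * w.2.im - z.2.im * w.2.re) = 0 := by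
    linarith
  linear_combination
    -(z.1.re * v.1.re + z.1.im * v.1.im + z.2.re * v.2.re + z.2.im * v.2.im) * hw' +
    (z.1.re * w.1.re + z.1.im * w.1.im + z.2.re * w.2.re + z.2.im * w.2.im) * hv'

theorem fderiv_liouvilleForm_apply {Y : ℂ × ℂ → ℂ × ℂ} {p : ℂ × ℂ} (hY : DifferentiableAt ℝ Y p)
    (v : ℂ × ℂ) : fderiv ℝ (fun z => liouvilleForm z (Y z)) p v =
      liouvilleForm v (Y p) + liouvilleForm p (fderiv ℝ Y p v) := by
  have h : HasFDerivAt (fun z => liouvilleCLM z (Y z)) _ p :=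
    (liouvilleCLM.hasFDerivAt (x := p)).clm_apply hY.hasFDerivAt
  rw [show (fun z => liouvilleForm z (Y z)) = fun z => liouvilleCLM z (Y z) from rfl, h.fderiv]
  simp only [add_apply, ContinuousLinearMap.comp_apply, ContinuousLinearMap.flip_apply]
  rw [add_comm]
  rfl

theorem liouvilleForm_skew (v w : ℂ × ℂ) : liouvilleForm v w = -liouvilleForm w v := by
  simp [liouvilleForm_apply]; ring

theorem dOneForm_eq_two_mul (p v w : ℂ × ℂ) :
    dOneForm liouvilleForm p v w = 2 * liouvilleForm v w := by
  rw [dOneForm_liouvilleForm, liouvilleForm_apply]; ring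

/-- A pair of contact vector fields satisfies `dλ(V, W) = -λ([V, W])`. -/
theorem liouvilleForm_lieBracket {V W : ℂ × ℂ → ℂ × ℂ} {p : ℂ × ℂ}
    (hV : DifferentiableAt ℝ V p) (hW : DifferentiableAt ℝ W p)
    (hVW : fderiv ℝ (fun z => liouvilleForm z (W z)) p (V p) = 0)
    (hWV : fderiv ℝ (fun z => liouvilleForm z (V z)) p (W p) = 0) :
    liouvilleForm p (VectorField.lieBracket ℝ V W p) = -dOneForm liouvilleForm p (V p) (W p) := by
  rw [fderiv_liouvilleForm_apply hW] at hVW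
  rw [fderiv_liouvilleForm_apply hV, liouvilleForm_skew] at hWV
  rw [VectorField.lieBracket, map_sub, dOneForm_eq_two_mul]
  linarith

theorem contDiffAt_liouvilleForm_apply {Y : ℂ × ℂ → ℂ × ℂ} {p : ℂ × ℂ} (hY : ContDiffAt ℝ ∞ Y p) :
    ContDiffAt ℝ ∞ (fun z => liouvilleForm z (Y z)) p :=
  (liouvilleCLM.contDiff.contDiffAt (x := p)).clm_apply hY

/-- The determinant is scaled by the complex trace `i (a + b)` of the linear field. -/
theorem hasDerivAt_areaForm_comp {a b : ℝ} {Y : ℂ × ℂ → ℂ × ℂ} {γ : ℝ → ℂ × ℂ} {t : ℝ} {W : ℂ × ℂ}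
    (hγ : HasDerivAt γ (rotationField a b (γ t)) t) (hY : DifferentiableAt ℝ Y (γ t))
    (hbr : fderiv ℝ Y (γ t) (rotationField a b (γ t)) = rotationField a b (Y (γ t)) + W) :
    HasDerivAt (fun t => areaForm (γ t) (Y (γ t)))
      (I * (a + b) * areaForm (γ t) (Y (γ t)) + areaForm (γ t) W) t := by
  have hY' := hY.hasFDerivAt.comp_hasDerivAt t hγ
  rw [hbr] at hY'
  have h1 := (ContinuousLinearMap.fst ℝ ℂ ℂ).hasFDerivAt.comp_hasDerivAt t hγ
  have h2 := (ContinuousLinearMap.snd ℝ ℂ ℂ).hasFDerivAt.comp_hasDerivAt t hγ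
  have h3 := (ContinuousLinearMap.fst ℝ ℂ ℂ).hasFDerivAt.comp_hasDerivAt t hY'
  have h4 := (ContinuousLinearMap.snd ℝ ℂ ℂ).hasFDerivAt.comp_hasDerivAt t hY'
  refine HasDerivAt.congr_deriv ((h1.mul h4).sub (h2.mul h3)) ?_
  simp [areaForm]
  ring

/-- A nowhere vanishing continuous function on the plane that has the form `c e^{i κ t}` along the
unit circle traversed with speed `a ≠ 0` must have `κ = 0`. -/
theorem eq_zero_of_winding {u : ℂ → ℂ} (hu : Continuous u) (hu0 : ∀ z, u z ≠ 0) {a k : ℝ}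
    (ha : a ≠ 0) (h : ∀ t : ℝ, u (Circle.exp (a * t)) = u 1 * Complex.exp (I * k * t)) : k = 0 := by
  -- The plane is simply connected, so `u` has a global logarithm. Along the circle it must equal `f
  -- 1 + i k t`, yet it returns to its value after the period `2π / a`.
  obtain ⟨f, ⟨-, hf⟩, -⟩ := isCoveringMapOn_exp.existsUnique_continuousMap_lifts
    ⟨u, hu⟩ (exp_log (hu0 1)) (fun z => hu0 z)
  have hf : ∀ z, Complex.exp (f z) = u z := fun z => congrFun hf z
  let g₁ : ℝ → ℂ := fun t => f (Circle.exp (a * t))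
  let g₂ : ℝ → ℂ := fun t => f 1 + I * k * t
  have hg : g₁ = g₂ := by
    refine isCoveringMap_exp.eq_of_comp_eq ?_ ?_ ?_ 0 ?_
    · exact f.continuous.comp (by fun_prop)
    · fun_prop
    · funext t
      refine Subtype.ext ?_
      change Complex.exp (f _) = Complex.exp (f 1 + I * k * t)
      rw [hf, h, Complex.exp_add, hf]
    · simp [g₁, g₂]
  have h1 := congrFun hg (2 * Real.pi / a)
  simp only [g₁, g₂, mul_div_cancel₀ _ ha, Circle.exp_two_pi, Circle.coe_one] at h1
  have h2 : I * k * ((2 * Real.pi / a : ℝ) : ℂ) = 0 := by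
    simpa using h1.symm
  have h3 : (2 * Real.pi / a : ℝ) ≠ 0 := div_ne_zero (by positivity) ha
  simpa [I_ne_zero, ha, Real.pi_ne_zero] using h2

/-! ### The frequencies add up to one -/

section Winding

variable {a b : ℝ} {R X₁ X₂ : ℂ × ℂ → ℂ × ℂ} {P Q K : ℂ × ℂ → ℝ} {p : ℂ × ℂ}

/-- For contact fields `dλ₀(X₁, X₂) = -λ₀([X₁, X₂])`, and only the `R` term of the bracket
contributes. -/
theorem IsContactCanonicalFrame.dOneForm_eq_neg_one {X : Set (ℂ × ℂ)} (hX : IsClosed X)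
    (hs : HasSmoothBoundary X) (hF : IsContactCanonicalFrame X liouvilleForm R X₁ X₂ P Q K)
    (hp : p ∈ frontier X) : dOneForm liouvilleForm p (X₁ p) (X₂ p) = -1 := by
  have s1 := hF.vectorField₁.smooth p hp
  have s2 := hF.vectorField₂.smooth p hp
  have h := liouvilleForm_lieBracket (s1.differentiableAt (by simp)) (s2.differentiableAt (by simp))
    ((hF.vectorField₁.tangent p hp).fderiv_eq_zero hX hs hp (contDiffAt_liouvilleForm_apply s2)
      (Eventually.of_forall hF.mem_contact₂))
    ((hF.vectorField₂.tangent p hp).fderiv_eq_zero hX hs hp (contDiffAt_liouvilleForm_apply s1)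
      (Eventually.of_forall hF.mem_contact₁))
  rw [hF.bracket_X₁_X₂ p hp] at h
  simp only [map_add, map_smul, hF.mem_contact₁ p hp, hF.mem_contact₂ p hp,
    hF.reeb.normalized p hp] at h
  simp at h
  linarith

theorem ne_zero_of_im_conj_mul_neg {v w : ℂ} (h : (conj v * w).im < 0) : v + I * w ≠ 0 := by
  intro h0
  have h1 : v = -(I * w) := eq_neg_of_add_eq_zero_left h0
  rw [h1] at h
  simp at h
  nlinarith [mul_self_nonneg w.re, mul_self_nonneg w.im]

theorem IsContactCanonicalFrame.add_eq_one (ha : 0 < a) (hb : 0 < b)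
    (hF : IsContactCanonicalFrame (ellipsoid a b) liouvilleForm R X₁ X₂ P Q K)
    (hK : ∀ q ∈ frontier (ellipsoid a b), K q = 1) : a + b = 1 := by
  have hX := isClosed_ellipsoid a b
  have hs := hasSmoothBoundary_ellipsoid (a := a) (b := b)
  have hc := hF.contact
  have hR := hF.reeb
  have hR' := isReebField_rotationField a b
  have hRe : ∀ q ∈ frontier (ellipsoid a b), R q = rotationField a b q := fun q hq =>
    reeb_unique hc hq (hR.vectorField.tangent q hq) (hR'.vectorField.tangent q hq)
      (hR.normalized q hq) (hR'.normalized q hq) (hR.kernel q hq) (hR'.kernel q hq)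
  have hDR : ∀ q ∈ frontier (ellipsoid a b), ∀ v, IsTangentToBoundary (ellipsoid a b) q v →
      fderiv ℝ R q v = rotationField a b v := fun q hq v hv => by
    rw [hv.fderiv_eq hX hs hq (hR.vectorField.smooth q hq)
      ((rotationField a b).contDiff.contDiffAt) (Eventually.of_forall hRe),
      (rotationField a b).fderiv]
  have br1 : ∀ q ∈ frontier (ellipsoid a b),
      fderiv ℝ X₁ q (rotationField a b q) = rotationField a b (X₁ q) + X₂ q := by
    intro q hq
    have := hF.bracket_R_X₁ q hq
    rw [hK q hq, one_smul, VectorField.lieBracket, hRe q hq,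
      hDR q hq _ (hF.vectorField₁.tangent q hq)] at this
    rw [← this]; abel
  have br2 : ∀ q ∈ frontier (ellipsoid a b),
      fderiv ℝ X₂ q (rotationField a b q) = rotationField a b (X₂ q) + -X₁ q := by
    intro q hq
    have := hF.bracket_X₂_R q hq
    rw [VectorField.lieBracket, hRe q hq, hDR q hq _ (hF.vectorField₂.tangent q hq)] at this
    rw [← this]; abel
  -- The sign of `dλ₀(X₁, X₂)` makes this combination nowhere zero, whereas `areaForm X₁ - i
  -- areaForm X₂` could vanish.
  set u : ℂ × ℂ → ℂ := fun z => areaForm z (X₁ z) + I * areaForm z (X₂ z) with hu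
  have hu0 : ∀ q ∈ frontier (ellipsoid a b), u q ≠ 0 := by
    intro q hq
    refine ne_zero_of_im_conj_mul_neg ?_
    rw [im_conj_areaForm_mul (hF.mem_contact₁ q hq) (hF.mem_contact₂ q hq),
      hF.dOneForm_eq_neg_one hX hs hq]
    have h1 := mem_frontier_ellipsoid.1 hq
    have g1 := normSq_nonneg q.1
    have g2 := normSq_nonneg q.2
    by_contra! hle
    have e1 : normSq q.1 = 0 := by linarith
    have e2 : normSq q.2 = 0 := by linarith
    rw [e1, e2] at h1
    norm_num at h1
  have huc : ∀ q ∈ frontier (ellipsoid a b), ContinuousAt u q := by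
    intro q hq
    have c1 := (hF.vectorField₁.smooth q hq).continuousAt
    have c2 := (hF.vectorField₂.smooth q hq).continuousAt
    simp only [hu, areaForm]
    fun_prop
  obtain ⟨r, ha2⟩ : ∃ r : ℝ, a * (r * r) = 2 := ⟨√(2 / a), by
    rw [Real.mul_self_sqrt (by positivity), mul_div_cancel₀ _ ha.ne']⟩
  obtain ⟨s, hb2⟩ : ∃ s : ℝ, b * (s * s) = 2 := ⟨√(2 / b), by
    rw [Real.mul_self_sqrt (by positivity), mul_div_cancel₀ _ hb.ne']⟩
  set p : ℂ × ℂ := ((r : ℝ), 0) with hp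
  have hpf : p ∈ frontier (ellipsoid a b) := by
    rw [mem_frontier_ellipsoid]
    simpa [hp, normSq_ofReal] using ha2
  set γ := torusOrbit a b p with hγ
  have hγf : ∀ t, γ t ∈ frontier (ellipsoid a b) := by
    intro t
    rw [mem_frontier_ellipsoid] at hpf ⊢
    simpa only [hγ, torusOrbit, torusRotation_apply, normSq_circle_mul] using hpf
  have hγd : ∀ t, HasDerivAt γ (rotationField a b (γ t)) t := fun t => by
    rw [rotationField_apply]; exact hasDerivAt_torusOrbit a b p t
  have hud : ∀ t, HasDerivAt (fun t => u (γ t)) (I * (a + b - 1 : ℝ) * u (γ t)) t := by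
    intro t
    have h1 := hasDerivAt_areaForm_comp (hγd t)
      ((hF.vectorField₁.smooth _ (hγf t)).differentiableAt (by simp)) (br1 _ (hγf t))
    have h2 := hasDerivAt_areaForm_comp (hγd t)
      ((hF.vectorField₂.smooth _ (hγf t)).differentiableAt (by simp)) (br2 _ (hγf t))
    refine (h1.add (h2.const_mul I)).congr_deriv ?_
    simp only [hu, areaForm, Prod.fst_neg, Prod.snd_neg]
    push_cast
    linear_combination ((γ t).1 * (X₂ (γ t)).2 - (γ t).2 * (X₂ (γ t)).1) * I_mul_I
  have hsol : ∀ t, u (γ t) = u p * Complex.exp (I * (a + b - 1 : ℝ) * t) := by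
    have h : ∀ t : ℝ, HasDerivAt
        (fun t : ℝ => u (γ t) * Complex.exp (-(I * (a + b - 1 : ℝ) * t))) 0 t := fun t => by
      have h1 : HasDerivAt (fun t : ℝ => -(I * (a + b - 1 : ℝ) * (t : ℂ)))
          (-(I * (a + b - 1 : ℝ))) t := by
        have h2 := ((ofRealCLM.hasDerivAt (x := t)).const_mul (I * (a + b - 1 : ℝ))).neg
        rw [ofRealCLM_apply, ofReal_one, mul_one] at h2
        exact h2
      refine ((hud t).mul h1.cexp).congr_deriv ?_
      ring
    intro t
    have h2 := is_const_of_deriv_eq_zero (fun t => (h t).differentiableAt)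
      (fun t => (h t).deriv) t 0
    simp only [hγ, torusOrbit_zero, ofReal_zero, mul_zero, neg_zero, Complex.exp_zero,
      mul_one] at h2
    rw [← h2, mul_assoc, ← Complex.exp_add, neg_add_cancel, Complex.exp_zero, mul_one]
  -- Inverse stereographic projection onto the 2-sphere in `ℂ × ℝ`, stretched to the ellipsoid. The
  -- unit circle goes to the closed orbit in `z₂ = 0`, which thus bounds a disc.
  let D : ℂ → ℂ × ℂ := fun z => (((r * (2 / (1 + normSq z)) : ℝ) : ℂ) * z,
    ((s * ((1 - normSq z) / (1 + normSq z)) : ℝ) : ℂ))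
  have hD0 : ∀ z : ℂ, (1 + normSq z) ≠ 0 := fun z => by linarith [normSq_nonneg z]
  have hDc : Continuous D := by
    have := continuous_normSq
    have h1 : Continuous fun z : ℂ => 2 / (1 + normSq z) :=
      continuous_const.div (by fun_prop) hD0
    have h2 : Continuous fun z : ℂ => (1 - normSq z) / (1 + normSq z) :=
      (by fun_prop : Continuous fun z : ℂ => 1 - normSq z).div (by fun_prop) hD0
    fun_prop
  have hDf : ∀ z, D z ∈ frontier (ellipsoid a b) := by
    intro z
    rw [mem_frontier_ellipsoid]
    simp only [D, normSq_mul, normSq_ofReal]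
    have := hD0 z
    generalize normSq z = n at *
    field_simp
    linear_combination 4 * n * ha2 + (1 - n) ^ 2 * hb2
  have hD1 : ∀ c : Circle, D c = ((c : ℂ) * (r : ℂ), 0) := by
    intro c
    have : normSq (c : ℂ) = 1 := by simp [normSq_eq_norm_sq, Circle.norm_coe]
    simp only [D, this]
    norm_num [mul_comm]
  have hDγ : ∀ t : ℝ, D (Circle.exp (a * t)) = γ t := fun t => by
    rw [hD1]
    simp [hγ, torusOrbit, hp]
  have hDp : D 1 = p := by
    have := hD1 1
    rw [Circle.coe_one] at this
    rw [this, hp]; simp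
  have := eq_zero_of_winding (u := u ∘ D)
    (continuous_iff_continuousAt.2 fun z => (huc _ (hDf z)).comp hDc.continuousAt)
    (fun z => hu0 _ (hDf z)) ha.ne' (k := a + b - 1)
    (fun t => by
      simp only [Function.comp, hDγ, hDp]
      exact hsol t)
  linarith

end Winding

/-! ### An explicit frame on the ellipsoid -/

section Converse

variable {a b : ℝ} {p v : ℂ × ℂ}

/-- The contact vector field on `ellipsoid a b` with `areaForm` a multiple of `θ`, before
normalization. -/
noncomputable def contactPolynomial (a b : ℝ) (θ : ℂ) (z : ℂ × ℂ) : ℂ × ℂ :=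
  (-(θ * ((b * (normSq z.1 + normSq z.2) + (a * normSq z.1 + b * normSq z.2) : ℝ) * conj z.2) +
      conj θ * ((b - a : ℝ) * (z.1 ^ 2 * z.2))),
    θ * ((a * (normSq z.1 + normSq z.2) + (a * normSq z.1 + b * normSq z.2) : ℝ) * conj z.1) -
      conj θ * ((b - a : ℝ) * (z.2 ^ 2 * z.1)))

/-- The contact vector field on `ellipsoid a b` whose `areaForm` at `z` is `θ |z|`. -/
noncomputable def contactField (a b : ℝ) (θ : ℂ) (z : ℂ × ℂ) : ℂ × ℂ :=
  (4 * √(normSq z.1 + normSq z.2))⁻¹ • contactPolynomial a b θ z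

theorem normSq_add_pos {z : ℂ × ℂ} (hz : z ≠ 0) : 0 < normSq z.1 + normSq z.2 := by
  have h1 := normSq_nonneg z.1
  have h2 := normSq_nonneg z.2
  refine lt_of_le_of_ne (by positivity) fun h => hz ?_
  exact Prod.ext (normSq_eq_zero.1 (by linarith)) (normSq_eq_zero.1 (by linarith))

theorem contDiffAt_contactField (a b : ℝ) (θ : ℂ) (hp : p ≠ 0) :
    ContDiffAt ℝ ∞ (contactField a b θ) p := by
  have h1 : ContDiff ℝ ∞ fun z : ℂ × ℂ => z.1 := contDiff_fst
  have h2 : ContDiff ℝ ∞ fun z : ℂ × ℂ => z.2 := contDiff_snd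
  have n1 : ContDiff ℝ ∞ fun z : ℂ × ℂ => normSq z.1 := by
    simp only [normSq_eq_norm_sq]; exact h1.norm_sq ℝ
  have n2 : ContDiff ℝ ∞ fun z : ℂ × ℂ => normSq z.2 := by
    simp only [normSq_eq_norm_sq]; exact h2.norm_sq ℝ
  have c1 : ContDiff ℝ ∞ fun z : ℂ × ℂ => conj z.1 := conjCLE.contDiff.comp h1
  have c2 : ContDiff ℝ ∞ fun z : ℂ × ℂ => conj z.2 := conjCLE.contDiff.comp h2
  have co : ∀ c : ℝ, ContDiff ℝ ∞ fun z : ℂ × ℂ =>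
      ((c * (normSq z.1 + normSq z.2) + (a * normSq z.1 + b * normSq z.2) : ℝ) : ℂ) := fun c =>
    ofRealCLM.contDiff.comp ((contDiff_const.mul (n1.add n2)).add
      ((contDiff_const.mul n1).add (contDiff_const.mul n2)))
  have hpol : ContDiff ℝ ∞ (contactPolynomial a b θ) :=
    ((contDiff_const.mul ((co b).mul c2)).add
      (contDiff_const.mul (contDiff_const.mul ((h1.pow 2).mul h2)))).neg.prodMk
    ((contDiff_const.mul ((co a).mul c1)).sub
      (contDiff_const.mul (contDiff_const.mul ((h2.pow 2).mul h1))))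
  have hpos := normSq_add_pos hp
  have hs := Real.sqrt_pos.2 hpos
  have hf : ContDiffAt ℝ ∞ (fun z : ℂ × ℂ => (4 * √(normSq z.1 + normSq z.2))⁻¹) p :=
    (contDiffAt_const.mul ((n1.add n2).contDiffAt.sqrt hpos.ne')).inv (by positivity)
  exact hf.smul hpol.contDiffAt

theorem liouvilleForm_contactField (a b : ℝ) (θ : ℂ) (z : ℂ × ℂ) :
    liouvilleForm z (contactField a b θ z) = 0 := by
  rw [contactField, map_smul, smul_eq_mul]
  refine mul_eq_zero_of_right _ ?_
  rw [liouvilleForm_apply]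
  simp [contactPolynomial, normSq_apply, pow_two]
  ring

theorem liouvilleForm_rotationField (a b : ℝ) (z v : ℂ × ℂ) :
    liouvilleForm (rotationField a b z) v =
      -(a * (conj z.1 * v.1).re + b * (conj z.2 * v.2).re) / 2 := by
  rw [liouvilleForm_apply]
  simp
  ring

theorem liouvilleForm_rotationField_comm (a b : ℝ) (z v : ℂ × ℂ) :
    liouvilleForm (rotationField a b z) v = liouvilleForm (rotationField a b v) z := by
  rw [liouvilleForm_rotationField, liouvilleForm_rotationField]
  simp
  ring

theorem isTangentToBoundary_ellipsoid_iff_liouvilleForm (hp : p ∈ frontier (ellipsoid a b)) :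
    IsTangentToBoundary (ellipsoid a b) p v ↔ liouvilleForm (rotationField a b p) v = 0 := by
  rw [isTangentToBoundary_ellipsoid hp, liouvilleForm_rotationField]
  constructor <;> intro h <;> linarith

theorem liouvilleForm_rotationField_contactField (a b : ℝ) (θ : ℂ) (z : ℂ × ℂ) :
    liouvilleForm (rotationField a b z) (contactField a b θ z) = 0 := by
  rw [contactField, map_smul, smul_eq_mul]
  refine mul_eq_zero_of_right _ ?_
  rw [liouvilleForm_rotationField]
  simp [contactPolynomial, normSq_apply, pow_two]
  ring

/-- A vector in the kernel of `λ₀` with determinant `η` is `(η (-conj z₂, conj z₁) + m z) / |z|²`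
with `m` real, and tangency determines `m`. Clearing denominators by `2 |z|² (a |z₁|² + b |z₂|²)`
gives `contactPolynomial`, and this factor is `4 |z|²` on the boundary. -/
theorem areaForm_contactField (hp : p ∈ frontier (ellipsoid a b)) (hp0 : p ≠ 0) (θ : ℂ) :
    areaForm p (contactField a b θ p) = θ * √(normSq p.1 + normSq p.2) := by
  have h1 : areaForm p (contactPolynomial a b θ p) =
      θ * (4 * (normSq p.1 + normSq p.2) : ℝ) := by
    have h := congrArg (fun x : ℝ => (x : ℂ)) (mem_frontier_ellipsoid.1 hp)
    simp only [areaForm, contactPolynomial]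
    push_cast at h ⊢
    simp only [normSq_eq_conj_mul_self] at h ⊢
    linear_combination 2 * θ * (conj p.1 * p.1 + conj p.2 * p.2) * h
  have h2 : areaForm p (contactField a b θ p) =
      ((4 * √(normSq p.1 + normSq p.2))⁻¹ : ℝ) * areaForm p (contactPolynomial a b θ p) := by
    simp only [areaForm, contactField, Prod.smul_fst, Prod.smul_snd, real_smul]
    ring
  have hpos := normSq_add_pos hp0
  have hs := Real.sqrt_pos.2 hpos
  rw [h2, h1, mul_left_comm, ← ofReal_mul]
  congr 2
  rw [inv_mul_eq_iff_eq_mul₀ (by positivity)]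
  linear_combination (-4) * Real.mul_self_sqrt hpos.le

/-- A zero determinant makes `v` a complex multiple of `p`, `λ₀(v) = 0` makes the multiple real, and
the radial direction is not tangent. -/
theorem eq_zero_of_areaForm_eq_zero (hp : p ∈ frontier (ellipsoid a b)) (hp0 : p ≠ 0)
    (hv : IsTangentToBoundary (ellipsoid a b) p v) (hl : liouvilleForm p v = 0)
    (h : areaForm p v = 0) : v = 0 := by
  rw [isTangentToBoundary_ellipsoid hp] at hv
  rw [liouvilleForm_apply] at hl
  have hE := mem_frontier_ellipsoid.1 hp
  have hn := (normSq_add_pos hp0).ne'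
  have hn' : ((normSq p.1 : ℂ) + normSq p.2) ≠ 0 := by exact_mod_cast hn
  have e1 : ((normSq p.1 : ℂ) + normSq p.2) * v.1 = p.1 * (conj p.1 * v.1 + conj p.2 * v.2) := by
    rw [areaForm] at h
    rw [normSq_eq_conj_mul_self, normSq_eq_conj_mul_self]
    linear_combination -conj p.2 * h
  have e2 : ((normSq p.1 : ℂ) + normSq p.2) * v.2 = p.2 * (conj p.1 * v.1 + conj p.2 * v.2) := by
    rw [areaForm] at h
    rw [normSq_eq_conj_mul_self, normSq_eq_conj_mul_self]
    linear_combination conj p.1 * h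
  have him : (conj p.1 * v.1 + conj p.2 * v.2).im = 0 := by rw [add_im]; linarith
  have hm : conj p.1 * v.1 + conj p.2 * v.2 = ((conj p.1 * v.1 + conj p.2 * v.2).re : ℝ) := by
    apply Complex.ext
    · rw [ofReal_re]
    · rw [ofReal_im, him]
  have f1 : (normSq p.1 + normSq p.2) * (conj p.1 * v.1).re =
      normSq p.1 * (conj p.1 * v.1 + conj p.2 * v.2).re := by
    have h3 : (((normSq p.1 + normSq p.2 : ℝ) : ℂ) * (conj p.1 * v.1)) =
        ((normSq p.1 : ℝ) : ℂ) * (conj p.1 * v.1 + conj p.2 * v.2) := by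
      rw [normSq_eq_conj_mul_self (z := p.1)]
      push_cast
      linear_combination conj p.1 * e1
    simpa only [re_ofReal_mul] using congrArg re h3
  have f2 : (normSq p.1 + normSq p.2) * (conj p.2 * v.2).re =
      normSq p.2 * (conj p.1 * v.1 + conj p.2 * v.2).re := by
    have h3 : (((normSq p.1 + normSq p.2 : ℝ) : ℂ) * (conj p.2 * v.2)) =
        ((normSq p.2 : ℝ) : ℂ) * (conj p.1 * v.1 + conj p.2 * v.2) := by
      rw [normSq_eq_conj_mul_self (z := p.2)]
      push_cast
      linear_combination conj p.2 * e2
    simpa only [re_ofReal_mul] using congrArg re h3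
  have hre : (conj p.1 * v.1 + conj p.2 * v.2).re = 0 := by
    linear_combination (normSq p.1 + normSq p.2) / 2 * hv - a / 2 * f1 - b / 2 * f2 -
      (conj p.1 * v.1 + conj p.2 * v.2).re / 2 * hE
  rw [hm, hre, ofReal_zero, mul_zero] at e1 e2
  exact Prod.ext ((mul_eq_zero.1 e1).resolve_left hn') ((mul_eq_zero.1 e2).resolve_left hn')

theorem isTangent_contactField (hp : p ∈ frontier (ellipsoid a b)) (θ : ℂ) :
    IsTangentToBoundary (ellipsoid a b) p (contactField a b θ p) :=
  (isTangentToBoundary_ellipsoid_iff_liouvilleForm hp).2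
    (liouvilleForm_rotationField_contactField a b θ p)

theorem dOneForm_contactField (hp : p ∈ frontier (ellipsoid a b)) (hp0 : p ≠ 0) :
    dOneForm liouvilleForm p (contactField a b 1 p) (contactField a b (-I) p) = -1 := by
  have h := im_conj_areaForm_mul (liouvilleForm_contactField a b 1 p)
    (liouvilleForm_contactField a b (-I) p)
  rw [areaForm_contactField hp hp0, areaForm_contactField hp hp0] at h
  have hpos := normSq_add_pos hp0
  have hs := Real.mul_self_sqrt hpos.le
  simp [-neg_mul] at h
  refine mul_left_cancel₀ hpos.ne' ?_
  linarith

/-- Expansion of a contact vector in the frame `contactField a b 1`, `contactField a b (-I)`. -/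
theorem eq_contactField_combination (hp : p ∈ frontier (ellipsoid a b)) (hp0 : p ≠ 0)
    (hv : IsTangentToBoundary (ellipsoid a b) p v) (hl : liouvilleForm p v = 0) :
    v = -dOneForm liouvilleForm p v (contactField a b (-I) p) • contactField a b 1 p +
      -dOneForm liouvilleForm p (contactField a b 1 p) v • contactField a b (-I) p := by
  have l1 := liouvilleForm_contactField a b 1 p
  have l2 := liouvilleForm_contactField a b (-I) p
  have t1 := isTangent_contactField hp 1
  have t2 := isTangent_contactField hp (-I)
  have d12 := dOneForm_contactField hp hp0
  have i12 := im_conj_areaForm_mul l1 l2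
  have iv2 := im_conj_areaForm_mul hl l2
  have i1v := im_conj_areaForm_mul l1 hl
  rw [d12] at i12
  generalize contactField a b 1 p = x at *
  generalize contactField a b (-I) p = y at *
  rw [← sub_eq_zero]
  refine eq_zero_of_areaForm_eq_zero hp hp0 (hv.sub ((t1.smul _).add (t2.smul _)))
    (by simp [hl, l1, l2]) ?_
  generalize dOneForm liouvilleForm p v y = m at *
  generalize dOneForm liouvilleForm p x v = k at *
  have hn := normSq_add_pos hp0
  have hn' : ((normSq p.1 + normSq p.2 : ℝ) : ℂ) ≠ 0 := by exact_mod_cast hn.ne'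
  have e : areaForm p (v - (-m • x + -k • y)) = areaForm p v + m * areaForm p x +
      k * areaForm p y := by
    simp [areaForm]; ring
  rw [e]
  refine (mul_eq_zero.1 ?_).resolve_left hn'
  have e1 : ((normSq p.1 + normSq p.2 : ℝ) : ℂ) * (areaForm p v + m * areaForm p x +
      k * areaForm p y) = -(((normSq p.1 + normSq p.2) * (-1) : ℝ) : ℂ) * areaForm p v +
      (((normSq p.1 + normSq p.2) * m : ℝ) : ℂ) * areaForm p x +
      (((normSq p.1 + normSq p.2) * k : ℝ) : ℂ) * areaForm p y := by
    push_cast; ring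
  -- What remains is Cramer's rule in the real plane `ℂ`, with `Im (conj x * y)` as determinant.
  rw [e1, ← i12, ← iv2, ← i1v]
  apply Complex.ext <;> simp <;> ring

/-- Along the flow `conj z₂` turns with frequency `-b = a - 1` and `z₁² z₂` with `2a + b = a + 1`;
relative to the rotation `a` of the first coordinate this replaces `θ` by `e^{-it} θ`. The second
coordinate is symmetric. -/
theorem fderiv_contactField_rotationField (hab : a + b = 1) (θ : ℂ) (hp : p ≠ 0) :
    fderiv ℝ (contactField a b θ) p (rotationField a b p) =
      rotationField a b (contactField a b θ p) + contactField a b (-I * θ) p := by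
  have h1 := hasDerivAt_torusOrbit a b p 0
  rw [torusOrbit_zero] at h1
  have hX : HasFDerivAt (contactField a b θ) (fderiv ℝ (contactField a b θ) p)
      (torusOrbit a b p 0) := by
    rw [torusOrbit_zero]
    exact ((contDiffAt_contactField a b θ hp).differentiableAt (by simp)).hasFDerivAt
  have h2 := hX.comp_hasDerivAt 0 h1
  set γ := torusOrbit a b p with hγ
  have hγ0 : γ 0 = p := torusOrbit_zero a b p
  have hn1 : ∀ t, normSq (γ t).1 = normSq p.1 := fun t => by
    simp only [hγ, torusOrbit, torusRotation_apply, normSq_circle_mul]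
  have hn2 : ∀ t, normSq (γ t).2 = normSq p.2 := fun t => by
    simp only [hγ, torusOrbit, torusRotation_apply, normSq_circle_mul]
  have hcomp : contactField a b θ ∘ γ = fun t => (4 * √(normSq p.1 + normSq p.2))⁻¹ •
      ((-(θ * ((b * (normSq p.1 + normSq p.2) + (a * normSq p.1 + b * normSq p.2) : ℝ) *
        conj (γ t).2) + conj θ * ((b - a : ℝ) * ((γ t).1 ^ 2 * (γ t).2))),
      θ * ((a * (normSq p.1 + normSq p.2) + (a * normSq p.1 + b * normSq p.2) : ℝ) *
        conj (γ t).1) - conj θ * ((b - a : ℝ) * ((γ t).2 ^ 2 * (γ t).1))) : ℂ × ℂ) := by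
    funext t
    simp only [Function.comp, contactField, contactPolynomial, hn1, hn2]
  rw [hcomp] at h2
  have g1 : HasDerivAt (fun t => (γ t).1) (I * a * p.1) 0 :=
    (ContinuousLinearMap.fst ℝ ℂ ℂ).hasFDerivAt.comp_hasDerivAt 0 h1
  have g2 : HasDerivAt (fun t => (γ t).2) (I * b * p.2) 0 :=
    (ContinuousLinearMap.snd ℝ ℂ ℂ).hasFDerivAt.comp_hasDerivAt 0 h1
  have c1 : HasDerivAt (fun t => conj (γ t).1) (conj (I * a * p.1)) 0 :=
    conjCLE.toContinuousLinearMap.hasFDerivAt.comp_hasDerivAt 0 g1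
  have c2 : HasDerivAt (fun t => conj (γ t).2) (conj (I * b * p.2)) 0 :=
    conjCLE.toContinuousLinearMap.hasFDerivAt.comp_hasDerivAt 0 g2
  have k1 := (((c2.const_mul ((b * (normSq p.1 + normSq p.2) +
    (a * normSq p.1 + b * normSq p.2) : ℝ) : ℂ)).const_mul θ).add
    ((((g1.pow 2).mul g2).const_mul ((b - a : ℝ) : ℂ)).const_mul (conj θ))).neg
  have k2 := (((c1.const_mul ((a * (normSq p.1 + normSq p.2) +
    (a * normSq p.1 + b * normSq p.2) : ℝ) : ℂ)).const_mul θ).sub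
    ((((g2.pow 2).mul g1).const_mul ((b - a : ℝ) : ℂ)).const_mul (conj θ)))
  have h3 := (k1.prodMk k2).const_smul (4 * √(normSq p.1 + normSq p.2))⁻¹
  rw [rotationField_apply]
  refine (h2.unique h3).trans ?_
  have hab' : (b : ℂ) = 1 - a := by rw [eq_sub_iff_add_eq, add_comm]; exact_mod_cast hab
  simp only [contactField, contactPolynomial, rotationField_apply, hγ0]
  generalize ((b * (normSq p.1 + normSq p.2) + (a * normSq p.1 + b * normSq p.2) : ℝ) : ℂ) = A
  generalize ((a * (normSq p.1 + normSq p.2) + (a * normSq p.1 + b * normSq p.2) : ℝ) : ℂ) = B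
  generalize ((b - a : ℝ) : ℂ) = D
  generalize (4 * √(normSq p.1 + normSq p.2))⁻¹ = f
  ext1 <;> simp [hab', hγ0] <;> ring

theorem ne_zero_of_mem_frontier_ellipsoid (hp : p ∈ frontier (ellipsoid a b)) : p ≠ 0 := by
  rintro rfl
  simpa using mem_frontier_ellipsoid.1 hp

theorem isContactForm_ellipsoid (a b : ℝ) :
    IsContactFormOnBoundary (ellipsoid a b) liouvilleForm := by
  intro p hp
  have hp0 := ne_zero_of_mem_frontier_ellipsoid hp
  have hR := isReebField_rotationField a b
  refine ⟨⟨rotationField a b p, hR.vectorField.tangent p hp, ?_⟩, fun v hv hl h => ?_⟩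
  · rw [hR.normalized p hp]
    exact one_ne_zero
  · have h1 := h _ (isTangent_contactField hp 1) (liouvilleForm_contactField a b 1 p)
    have h2 := h _ (isTangent_contactField hp (-I)) (liouvilleForm_contactField a b (-I) p)
    rw [dOneForm_eq_two_mul, liouvilleForm_skew, ← neg_eq_zero] at h1
    rw [eq_contactField_combination hp hp0 hv hl, h2, dOneForm_eq_two_mul]
    rw [show 2 * liouvilleForm (contactField a b 1 p) v = 0 by linarith]
    simp

theorem fderiv_liouvilleForm_comp_rotationField {Y : ℂ × ℂ → ℂ × ℂ} (hY : DifferentiableAt ℝ Y p)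
    (v : ℂ × ℂ) : fderiv ℝ (fun z => liouvilleForm (rotationField a b z) (Y z)) p v =
      liouvilleForm (rotationField a b v) (Y p) +
        liouvilleForm (rotationField a b p) (fderiv ℝ Y p v) := by
  have h : HasFDerivAt (fun z => liouvilleCLM (rotationField a b z) (Y z)) _ p :=
    ((liouvilleCLM.comp (rotationField a b)).hasFDerivAt (x := p)).clm_apply hY.hasFDerivAt
  rw [show (fun z => liouvilleForm (rotationField a b z) (Y z)) =
    fun z => liouvilleCLM (rotationField a b z) (Y z) from rfl, h.fderiv]
  simp only [add_apply, ContinuousLinearMap.comp_apply, ContinuousLinearMap.flip_apply]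
  rw [add_comm]
  rfl

/-- The fields are tangent to every level set of the quadratic form, so the tangency identity may be
differentiated in all directions of `ℂ²`; the Hessian terms cancel by symmetry. -/
theorem isTangent_lieBracket_contactField (hp : p ∈ frontier (ellipsoid a b)) (θ η : ℂ) :
    IsTangentToBoundary (ellipsoid a b) p
      (VectorField.lieBracket ℝ (contactField a b θ) (contactField a b η) p) := by
  have hp0 := ne_zero_of_mem_frontier_ellipsoid hp
  have hd : ∀ θ, DifferentiableAt ℝ (contactField a b θ) p := fun θ =>
    (contDiffAt_contactField a b θ hp0).differentiableAt (by simp)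
  have h : ∀ θ v, liouvilleForm (rotationField a b v) (contactField a b θ p) +
      liouvilleForm (rotationField a b p) (fderiv ℝ (contactField a b θ) p v) = 0 := by
    intro θ v
    rw [← fderiv_liouvilleForm_comp_rotationField (hd θ)]
    simp [-rotationField_apply, liouvilleForm_rotationField_contactField]
  rw [isTangentToBoundary_ellipsoid_iff_liouvilleForm hp, VectorField.lieBracket, map_sub]
  have h1 := h η (contactField a b θ p)
  have h2 := h θ (contactField a b η p)
  rw [liouvilleForm_rotationField_comm] at h2
  linarith

theorem liouvilleForm_lieBracket_contactField (hp : p ∈ frontier (ellipsoid a b)) :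
    liouvilleForm p (VectorField.lieBracket ℝ (contactField a b 1) (contactField a b (-I)) p)
      = 1 := by
  have hp0 := ne_zero_of_mem_frontier_ellipsoid hp
  have hd : ∀ θ, DifferentiableAt ℝ (contactField a b θ) p := fun θ =>
    (contDiffAt_contactField a b θ hp0).differentiableAt (by simp)
  rw [liouvilleForm_lieBracket (hd _) (hd _) (by simp [liouvilleForm_contactField])
    (by simp [liouvilleForm_contactField]), dOneForm_contactField hp hp0, neg_neg]

theorem contactField_neg (a b : ℝ) (θ : ℂ) (z : ℂ × ℂ) :
    contactField a b (-θ) z = -contactField a b θ z := by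
  rw [contactField, contactField, ← smul_neg]
  congr 1
  ext1 <;> simp [contactPolynomial] <;> ring

theorem isBoundaryVectorField_contactField (a b : ℝ) (θ : ℂ) :
    IsBoundaryVectorField (ellipsoid a b) (contactField a b θ) where
  smooth := fun _ hp => contDiffAt_contactField a b θ (ne_zero_of_mem_frontier_ellipsoid hp)
  tangent := fun _ hp => isTangent_contactField hp θ

/-- Applying `λ₀` and the pairings of `dλ₀` with the two contact vectors to a linear relation
isolates each coefficient. -/
theorem linearIndependent_contactFrame (hp : p ∈ frontier (ellipsoid a b)) :
    LinearIndependent ℝ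
      ![rotationField a b p, contactField a b 1 p, contactField a b (-I) p] := by
  have hR := isReebField_rotationField a b
  have l1 := liouvilleForm_contactField a b 1 p
  have l2 := liouvilleForm_contactField a b (-I) p
  have r1 := hR.kernel p hp _ (isTangent_contactField hp 1)
  have r2 := hR.kernel p hp _ (isTangent_contactField hp (-I))
  have d := dOneForm_contactField hp (ne_zero_of_mem_frontier_ellipsoid hp)
  have r0 := hR.normalized p hp
  generalize rotationField a b p = r at *
  generalize contactField a b 1 p = x at *
  generalize contactField a b (-I) p = y at *
  rw [Fintype.linearIndependent_iff]
  intro g hg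
  simp only [Fin.sum_univ_three, Matrix.cons_val_zero, Matrix.cons_val_one,
    Matrix.cons_val] at hg
  rw [dOneForm_eq_two_mul] at r1 r2 d
  have s1 := liouvilleForm_skew x r
  have s2 := liouvilleForm_skew y r
  have s3 := liouvilleForm_skew y x
  have sx : liouvilleForm x x = 0 := by linarith [liouvilleForm_skew x x]
  have sy : liouvilleForm y y = 0 := by linarith [liouvilleForm_skew y y]
  have e0 := congrArg (liouvilleForm p) hg
  have e1 := congrArg (liouvilleForm y) hg
  have e2 := congrArg (liouvilleForm x) hg
  simp only [map_add, map_smul, smul_eq_mul, map_zero, r0, l1, l2] at e0 e1 e2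
  have g0 : g 0 = 0 := by linarith
  have hry : liouvilleForm y r = 0 := by linarith
  have hrx : liouvilleForm x r = 0 := by linarith
  have hyx : liouvilleForm y x = 1 / 2 := by linarith
  have hxy : liouvilleForm x y = -1 / 2 := by linarith
  rw [hry, hyx, sy] at e1
  rw [hrx, hxy, sx] at e2
  intro i
  fin_cases i
  · exact g0
  · change g 1 = 0; linarith
  · change g 2 = 0; linarith

theorem exists_contactCanonicalFrame_ellipsoid (hab : a + b = 1) :
    ∃ (R X₁ X₂ : ℂ × ℂ → ℂ × ℂ) (P Q K : ℂ × ℂ → ℝ),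
      IsContactCanonicalFrame (ellipsoid a b) liouvilleForm R X₁ X₂ P Q K ∧
        ∀ p ∈ frontier (ellipsoid a b), K p = 1 := by
  have hR := isReebField_rotationField a b
  set V := VectorField.lieBracket ℝ (contactField a b 1) (contactField a b (-I)) with hV
  have hsm : ∀ θ, ∀ p ∈ frontier (ellipsoid a b), ContDiffAt ℝ ∞ (contactField a b θ) p :=
    fun θ p hp => contDiffAt_contactField a b θ (ne_zero_of_mem_frontier_ellipsoid hp)
  have hVs : ∀ p ∈ frontier (ellipsoid a b), ContDiffAt ℝ ∞ V p := fun p hp =>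
    (hsm 1 p hp).lieBracket_vectorField (hsm (-I) p hp) (by simp)
  have hform : ∀ {Y Z : ℂ × ℂ → ℂ × ℂ} {p : ℂ × ℂ}, ContDiffAt ℝ ∞ Y p → ContDiffAt ℝ ∞ Z p →
      ContDiffAt ℝ ∞ (fun z => -dOneForm liouvilleForm z (Y z) (Z z)) p := by
    intro Y Z p hY hZ
    simp only [dOneForm_eq_two_mul]
    exact (contDiffAt_const.mul
      ((liouvilleCLM.contDiff.contDiffAt.comp p hY).clm_apply hZ)).neg
  refine ⟨rotationField a b, contactField a b 1, contactField a b (-I),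
    -- The functions `I` and `J` are the coordinates of the contact vector `[X₁, X₂] - R` in the
    -- frame; `R` drops out because it lies in the kernel of `dλ₀`.
    fun z => -dOneForm liouvilleForm z (V z) (contactField a b (-I) z),
    fun z => -dOneForm liouvilleForm z (contactField a b 1 z) (V z), fun _ => 1,
    { contact := isContactForm_ellipsoid a b
      reeb := hR
      vectorField₁ := isBoundaryVectorField_contactField a b 1
      vectorField₂ := isBoundaryVectorField_contactField a b (-I)
      mem_contact₁ := fun p _ => liouvilleForm_contactField a b 1 p
      mem_contact₂ := fun p _ => liouvilleForm_contactField a b (-I) p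
      linearIndependent := fun p hp => linearIndependent_contactFrame hp
      smooth_I := fun p hp => hform (hVs p hp) (hsm (-I) p hp)
      smooth_J := fun p hp => hform (hsm 1 p hp) (hVs p hp)
      smooth_K := fun p _ => contDiffAt_const
      bracket_X₂_R := fun p hp => ?_
      bracket_X₁_X₂ := fun p hp => ?_
      bracket_R_X₁ := fun p hp => ?_ }, fun _ _ => rfl⟩
  · rw [VectorField.lieBracket, (rotationField a b).fderiv,
      fderiv_contactField_rotationField hab _ (ne_zero_of_mem_frontier_ellipsoid hp),
      show -I * -I = -(1 : ℂ) by linear_combination I_mul_I,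
      contactField_neg a b 1]
    abel
  · have hp0 := ne_zero_of_mem_frontier_ellipsoid hp
    have h := eq_contactField_combination hp hp0
      ((isTangent_lieBracket_contactField hp 1 (-I)).sub (hR.vectorField.tangent p hp))
      (by rw [map_sub, liouvilleForm_lieBracket_contactField hp, hR.normalized p hp, sub_self])
    rw [← hV] at h
    have r1 := hR.kernel p hp _ (isTangent_contactField hp 1)
    have r2 := hR.kernel p hp _ (isTangent_contactField hp (-I))
    have e1 : dOneForm liouvilleForm p (V p - rotationField a b p) (contactField a b (-I) p) =
        dOneForm liouvilleForm p (V p) (contactField a b (-I) p) := by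
      rw [dOneForm_eq_two_mul, liouvilleForm_skew] at r2 ⊢
      rw [dOneForm_eq_two_mul, liouvilleForm_skew (V p), map_sub]
      linarith
    have e2 : dOneForm liouvilleForm p (contactField a b 1 p) (V p - rotationField a b p) =
        dOneForm liouvilleForm p (contactField a b 1 p) (V p) := by
      rw [dOneForm_eq_two_mul, liouvilleForm_skew] at r1
      rw [dOneForm_eq_two_mul, dOneForm_eq_two_mul, map_sub]
      linarith
    rw [e1, e2, sub_eq_iff_eq_add] at h
    exact h.trans (by rw [add_comm, add_assoc])
  · rw [VectorField.lieBracket, (rotationField a b).fderiv,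
      fderiv_contactField_rotationField hab _ (ne_zero_of_mem_frontier_ellipsoid hp), mul_one,
      one_smul]
    abel

end Converse

/-! ### Translation to symplectic ellipsoids and conclusion -/

theorem symplecticEllipsoid_eq_ellipsoid (a b : ℝ) :
    symplecticEllipsoid a b = ellipsoid (2 * Real.pi / a) (2 * Real.pi / b) := by
  ext z
  simp only [symplecticEllipsoid, ellipsoid, mem_ofPred_eq, normSq_eq_norm_sq]
  have : 2 * Real.pi / a * ‖z.1‖ ^ 2 + 2 * Real.pi / b * ‖z.2‖ ^ 2 =
      2 * (Real.pi * (‖z.1‖ ^ 2 / a + ‖z.2‖ ^ 2 / b)) := by ring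
  rw [this]
  constructor <;> intro h <;> linarith

theorem two_pi_div_add_eq_one_iff {a b : ℝ} (ha : 0 < a) (hb : 0 < b) :
    2 * Real.pi / a + 2 * Real.pi / b = 1 ↔ Real.pi * (a + b) = a * b / 2 := by
  rw [div_add_div _ _ ha.ne' hb.ne', div_eq_one_iff_eq (mul_pos ha hb).ne']
  constructor <;> intro h <;> linarith

theorem theorem1p7 (Ω : Set (ℝ × ℝ)) (hΩ : IsSmoothStarShapedToricDomain Ω) :
    (∃ (R X₁ X₂ : ℂ × ℂ → ℂ × ℂ) (I J K : ℂ × ℂ → ℝ),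
      IsContactCanonicalFrame (toricDomain Ω) liouvilleForm R X₁ X₂ I J K ∧
        ∀ p ∈ frontier (toricDomain Ω), K p = 1) ↔
    ∃ a b : ℝ, 0 < a ∧ 0 < b ∧ toricDomain Ω = symplecticEllipsoid a b ∧
      Real.pi * (a + b) = a * b / 2 := by
  constructor
  · rintro ⟨R, X₁, X₂, P, Q, K, hF, hK⟩
    have hT := isTorusInvariant_toricDomain Ω
    obtain ⟨x, hx⟩ := hΩ.nonempty
    have h0 : (0 : ℂ × ℂ) ∈ toricDomain Ω := by
      have h := hΩ.starConvex hx zero_le_one le_rfl (add_zero 1)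
      simp only [smul_zero, zero_smul, add_zero] at h
      simp only [toricDomain, mem_ofPred_eq, Prod.fst_zero, Prod.snd_zero, norm_zero, ne_eq,
        OfNat.ofNat_ne_zero, not_false_eq_true, zero_pow, mul_zero]
      exact h
    obtain ⟨a, b, ha, hb, hE⟩ := hF.exists_ellipsoid hK (isCompact_toricDomain hΩ.compact)
      hΩ.smooth_boundary hT (zero_mem_interior hT hΩ.smooth_boundary h0)
      (fun z hz t => starConvex_toricDomain hΩ.starConvex hz)
    change toricDomain Ω = ellipsoid a b at hE
    rw [hE] at hF hK ⊢
    have hab := hF.add_eq_one ha hb hK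
    have hpi := Real.pi_pos
    have e : ∀ c : ℝ, 0 < c → 2 * Real.pi / (2 * Real.pi / c) = c := fun c hc => by field_simp
    refine ⟨2 * Real.pi / a, 2 * Real.pi / b, by positivity, by positivity, ?_, ?_⟩
    · rw [symplecticEllipsoid_eq_ellipsoid, e a ha, e b hb]
    · rw [← two_pi_div_add_eq_one_iff (by positivity) (by positivity), e a ha, e b hb, hab]
  · rintro ⟨a, b, ha, hb, hE, hab⟩
    rw [hE, symplecticEllipsoid_eq_ellipsoid]
    exact exists_contactCanonicalFrame_ellipsoid ((two_pi_div_add_eq_one_iff ha hb).2 hab)
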